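/- Let $1<p<\infty$, and let $L^p(\mathbb{R})$ be the space of complex-valued $L^p$-functions with respect to Lebesgue measure. The shifts $(S(t)f)(s)=f(s-t)$, $t\in\mathbb{R}$, form a $C_0$-group of isometries on $L^p(\mathbb{R})$, and its generator is the operator $A_p=-\frac{d}{dx}$ (weak derivative) with domain $D(A_p)=W^{1,p}(\mathbb{R})$; this operator is also the generator of the $C_0$-semigroup $(S(t))_{t\ge 0}$. The operator $A_p$ is injective and has dense range. Its inverse $A_p^{-1}$, whose domain is the range of $A_p$, generates a $C_0$-semigroup on $L^p(\mathbb{R})$ if and only if $p=2$. -/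

import Mathlib

open MeasureTheory Filter Topology Set
open scoped ENNReal NNReal ContDiff

noncomputable section

namespace InverseGenerator

section Semigroups

variable {X : Type*} [NormedAddCommGroup X] [NormedSpace ℂ X]

/-- A `C_0`-semigroup: a strongly continuous one-parameter semigroup of bounded operators. -/
structure IsC0Semigroup (T : ℝ≥0 → X →L[ℂ] X) : Prop where
  map_zero : T 0 = ContinuousLinearMap.id ℂ X
  map_add : ∀ s t, T (s + t) = (T s).comp (T t)
  continuous_orbit : ∀ x, Continuous fun t => T t x

/-- A `C_0`-group: a strongly continuous one-parameter group of bounded operators. -/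
structure IsC0Group (S : ℝ → X →L[ℂ] X) : Prop where
  map_zero : S 0 = ContinuousLinearMap.id ℂ X
  map_add : ∀ s t, S (s + t) = (S s).comp (S t)
  continuous_orbit : ∀ x, Continuous fun t => S t x

/-- The (unbounded) operator `A` is the infinitesimal generator of the family `T`: one has
`x ∈ D(A)` and `A x = y` exactly if `(T(t)x - x) / t → y` in norm as `t ↓ 0`. -/
def IsSemigroupGenerator (A : X →ₗ.[ℂ] X) (T : ℝ≥0 → X →L[ℂ] X) : Prop :=
  ∀ x y : X, (x, y) ∈ A.graph ↔
    Tendsto (fun t : ℝ≥0 => ((t : ℝ) : ℂ)⁻¹ • (T t x - x)) (𝓝[>] 0) (𝓝 y)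

/-- The (unbounded) operator `A` is the infinitesimal generator of the family `S` indexed by `ℝ`:
one has `x ∈ D(A)` and `A x = y` exactly if `(S(t)x - x) / t → y` in norm as `t → 0`, `t ≠ 0`. -/
def IsGroupGenerator (A : X →ₗ.[ℂ] X) (S : ℝ → X →L[ℂ] X) : Prop :=
  ∀ x y : X, (x, y) ∈ A.graph ↔
    Tendsto (fun t : ℝ => (t : ℂ)⁻¹ • (S t x - x)) (𝓝[≠] 0) (𝓝 y)

/-- The operator `A` generates a `C_0`-semigroup. -/
def GeneratesC0Semigroup (A : X →ₗ.[ℂ] X) : Prop :=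
  ∃ T : ℝ≥0 → X →L[ℂ] X, IsC0Semigroup T ∧ IsSemigroupGenerator A T

end Semigroups

section Shift

set_option linter.unusedSectionVars false

variable (p : ℝ≥0∞) [Fact (1 ≤ p)]

/-- The space `L^p(ℝ)` of complex-valued functions with respect to Lebesgue measure. -/
abbrev LpReal : Type := Lp ℂ p (volume : Measure ℝ)

/-- The shift `(S(t)f)(s) = f(s - t)` on `L^p(ℝ)`. -/
def shift (t : ℝ) : LpReal p →L[ℂ] LpReal p :=
  (Lp.compMeasurePreservingₗᵢ ℂ (fun s : ℝ => s - t)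
    (measurePreserving_sub_right volume t)).toContinuousLinearMap

theorem coeFn_shift (t : ℝ) (f : LpReal p) :
    shift p t f =ᵐ[volume] fun s => f (s - t) :=
  Lp.coeFn_compMeasurePreserving f (measurePreserving_sub_right volume t)

variable {p}

/-- `g` is the weak (distributional) derivative of `f`. -/
def IsWeakDeriv (f g : LpReal p) : Prop :=
  ∀ φ : ℝ → ℝ, ContDiff ℝ ∞ φ → HasCompactSupport φ →
    ∫ x, deriv φ x • f x = -∫ x, φ x • g x

theorem integrable_smul_Lp (f : LpReal p) {φ : ℝ → ℝ} (hφ : Continuous φ)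
    (hc : HasCompactSupport φ) : Integrable (fun x => φ x • f x) :=
  ((Lp.memLp f).locallyIntegrable Fact.out).integrable_smul_left_of_hasCompactSupport hφ hc

theorem integrable_deriv_smul_Lp (f : LpReal p) {φ : ℝ → ℝ} (hφ : ContDiff ℝ ∞ φ)
    (hc : HasCompactSupport φ) : Integrable (fun x => deriv φ x • f x) :=
  integrable_smul_Lp f (hφ.continuous_deriv (by simp)) hc.deriv

theorem IsWeakDeriv.unique {f g g' : LpReal p} (h : IsWeakDeriv f g) (h' : IsWeakDeriv f g') :
    g = g' := by
  refine Lp.ext (ae_eq_of_integral_contDiff_smul_eq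
    ((Lp.memLp g).locallyIntegrable Fact.out) ((Lp.memLp g').locallyIntegrable Fact.out) ?_)
  intro φ hφ hc
  exact neg_injective ((h φ hφ hc).symm.trans (h' φ hφ hc))

theorem IsWeakDeriv.zero : IsWeakDeriv (0 : LpReal p) 0 := by
  intro φ _ _
  have h0 : (⇑(0 : LpReal p)) =ᵐ[volume] 0 := Lp.coeFn_zero _ _ _
  have h1 : ∫ x, deriv φ x • (0 : LpReal p) x = 0 :=
    integral_eq_zero_of_ae (h0.mono fun x hx => by simp only [hx, Pi.zero_apply, smul_zero])
  have h2 : ∫ x, φ x • (0 : LpReal p) x = 0 :=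
    integral_eq_zero_of_ae (h0.mono fun x hx => by simp only [hx, Pi.zero_apply, smul_zero])
  rw [h1, h2, neg_zero]

theorem IsWeakDeriv.add {f₁ f₂ g₁ g₂ : LpReal p} (h₁ : IsWeakDeriv f₁ g₁)
    (h₂ : IsWeakDeriv f₂ g₂) : IsWeakDeriv (f₁ + f₂) (g₁ + g₂) := by
  intro φ hφ hc
  have e₁ : ∫ x, deriv φ x • (f₁ + f₂) x = ∫ x, (deriv φ x • f₁ x + deriv φ x • f₂ x) :=
    integral_congr_ae ((Lp.coeFn_add f₁ f₂).mono fun x hx => by simp only [hx, Pi.add_apply, smul_add])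
  have e₂ : ∫ x, φ x • (g₁ + g₂) x = ∫ x, (φ x • g₁ x + φ x • g₂ x) :=
    integral_congr_ae ((Lp.coeFn_add g₁ g₂).mono fun x hx => by simp only [hx, Pi.add_apply, smul_add])
  rw [e₁, e₂, integral_add (integrable_deriv_smul_Lp _ hφ hc) (integrable_deriv_smul_Lp _ hφ hc),
    integral_add (integrable_smul_Lp _ hφ.continuous hc) (integrable_smul_Lp _ hφ.continuous hc),
    h₁ φ hφ hc, h₂ φ hφ hc, neg_add]

theorem IsWeakDeriv.smul (c : ℂ) {f g : LpReal p} (h : IsWeakDeriv f g) :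
    IsWeakDeriv (c • f) (c • g) := by
  intro φ hφ hc
  have e₁ : ∫ x, deriv φ x • (c • f) x = ∫ x, c • (deriv φ x • f x) :=
    integral_congr_ae ((Lp.coeFn_smul c f).mono fun x hx => by simp [hx, mul_left_comm])
  have e₂ : ∫ x, φ x • (c • g) x = ∫ x, c • (φ x • g x) :=
    integral_congr_ae ((Lp.coeFn_smul c g).mono fun x hx => by simp [hx, mul_left_comm])
  rw [e₁, e₂, integral_smul, integral_smul, h φ hφ hc, smul_neg]

variable (p)

/-- The Sobolev space `W^{1,p}(ℝ)`: all `f ∈ L^p(ℝ)` with a weak derivative in `L^p(ℝ)`. -/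
def sobolevW1 : Submodule ℂ (LpReal p) where
  carrier := {f | ∃ g : LpReal p, IsWeakDeriv f g}
  zero_mem' := ⟨0, IsWeakDeriv.zero⟩
  add_mem' := fun ⟨g₁, h₁⟩ ⟨g₂, h₂⟩ => ⟨g₁ + g₂, h₁.add h₂⟩
  smul_mem' := fun c _ ⟨g, h⟩ => ⟨c • g, h.smul c⟩

variable {p}

/-- The weak derivative of a function in `W^{1,p}(ℝ)`. -/
def weakDeriv (f : sobolevW1 p) : LpReal p := Classical.choose f.2

theorem isWeakDeriv_weakDeriv (f : sobolevW1 p) : IsWeakDeriv (f : LpReal p) (weakDeriv f) :=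
  Classical.choose_spec f.2

variable (p)

/-- The operator `A_p = -d/dx` on `L^p(ℝ)` with domain `D(A_p) = W^{1,p}(ℝ)`. -/
def shiftGenerator : LpReal p →ₗ.[ℂ] LpReal p where
  domain := sobolevW1 p
  toFun :=
    { toFun := fun f => -weakDeriv f
      map_add' := fun f g => by
        rw [(isWeakDeriv_weakDeriv (f + g)).unique
          ((isWeakDeriv_weakDeriv f).add (isWeakDeriv_weakDeriv g)), neg_add]
      map_smul' := fun c f => by
        rw [(isWeakDeriv_weakDeriv (c • f)).unique ((isWeakDeriv_weakDeriv f).smul c),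
          RingHom.id_apply, smul_neg] }

end Shift

end InverseGenerator

end

namespace InverseGenerator

/-! ### The shift group and its generator -/

section ShiftGroup

variable {p : ℝ≥0∞} [Fact (1 ≤ p)]

/-! Pairing with a test function moves the shift onto that function, where differentiation under the
integral is harmless; this identifies the generator with the negative weak derivative. Injectivity
and dense range come from a mean ergodic argument: kernel elements are shift invariant, every `S(t)f
- f` lies in the range, and for `1 < p < ∞` suitable Cesàro means of shifts of `f` are arbitrarily
small (`exists_norm_shiftMean_lt`).

For `p = 2` the Fourier transform turns `A` into multiplication by `-2πiξ`, hence `A⁻¹` into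
multiplication by `i/(2πξ)`. The symbol is purely imaginary, so its exponentials `exp(it/(2πξ))` are
unimodular and give a semigroup.

For `p ≠ 2` the equation `u' = A⁻¹u` has explicit solutions `u = α^(-1/2) exp(-2√(αβ))` with `α = a
- ix`, `β = b - it`, defined for all real `t`. By uniqueness for the Cauchy problem
(`IsC0Semigroup.apply_eq_of_hasDerivAt`) a semigroup generated by `A⁻¹` must transport them in time.
For `a = τ`, `b = 1/τ` and large `τ`, the `L^p` norm is a constant times `τ^(1/p - 1/2)` at `t = 0`,
at least `c τ^(2/p - 1)` at `t = 1`, and at most `C τ^(2/p - 1)` at `t = -1`. Letting `τ → ∞`,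
boundedness of `T(1)` fails on the passage from `0` to `1` if `p < 2`, and from `-1` to `0` if `p >
2`. -/

theorem norm_shift (t : ℝ) (f : LpReal p) : ‖shift p t f‖ = ‖f‖ :=
  (Lp.compMeasurePreservingₗᵢ ℂ (fun s : ℝ => s - t)
    (measurePreserving_sub_right volume t)).norm_map f

theorem shift_zero : shift p 0 = ContinuousLinearMap.id ℂ (LpReal p) := by
  ext1 f
  refine Lp.ext ?_
  filter_upwards [coeFn_shift p 0 f] with x hx
  simpa using hx

theorem shift_add (s t : ℝ) : shift p (s + t) = (shift p s).comp (shift p t) := by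
  ext1 f
  refine Lp.ext ?_
  filter_upwards [coeFn_shift p (s + t) f, coeFn_shift p s (shift p t f),
    (measurePreserving_sub_right volume s).quasiMeasurePreserving.ae (coeFn_shift p t f)]
    with x h₁ h₂ h₃
  rw [h₁, ContinuousLinearMap.comp_apply, h₂, h₃, sub_sub]

theorem continuous_shift (hp : p ≠ ⊤) (f : LpReal p) : Continuous fun t => shift p t f := by
  have hg : Continuous fun t : ℝ => (⟨fun s : ℝ => s - t, by fun_prop⟩ : C(ℝ, ℝ)) :=
    ContinuousMap.continuous_of_continuous_uncurry _
      (continuous_snd.sub continuous_fst : Continuous fun q : ℝ × ℝ => q.2 - q.1)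
  exact (continuous_const (y := f)).compMeasurePreservingLp hg
    (fun t => measurePreserving_sub_right volume t) hp

theorem isC0Group_shift (hp : p ≠ ⊤) : IsC0Group (shift p) :=
  ⟨shift_zero, shift_add, continuous_shift hp⟩

/-- Integration against a continuous function with compact support is a bounded functional. -/
theorem exists_clm_eq_integral_smul {φ : ℝ → ℝ} (hφ : Continuous φ) (hc : HasCompactSupport φ) :
    ∃ L : LpReal p →L[ℂ] ℂ, ∀ f, L f = ∫ x, φ x • f x := by
  have hm : MemLp (fun x => (φ x : ℂ)) (ENNReal.conjExponent p) :=
    (Complex.continuous_ofReal.comp hφ).memLp_of_hasCompactSupport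
      (hc.comp_left Complex.ofReal_zero)
  have : (ENNReal.conjExponent p).HolderConjugate p := (inferInstance : p.HolderConjugate _).symm
  have : Fact (1 ≤ ENNReal.conjExponent p) :=
    ⟨ENNReal.HolderConjugate.one_le (ENNReal.conjExponent p) p⟩
  refine ⟨(ContinuousLinearMap.mul ℂ ℂ).lpPairing volume (ENNReal.conjExponent p) p (hm.toLp _),
    fun f => ?_⟩
  rw [ContinuousLinearMap.lpPairing_eq_integral]
  refine integral_congr_ae ?_
  filter_upwards [hm.coeFn_toLp] with x hx
  simp [hx]

theorem eq_of_forall_integral_smul_eq {f g : LpReal p}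
    (h : ∀ φ : ℝ → ℝ, ContDiff ℝ ∞ φ → HasCompactSupport φ →
      ∫ x, φ x • f x = ∫ x, φ x • g x) : f = g :=
  Lp.ext (ae_eq_of_integral_contDiff_smul_eq
    ((Lp.memLp f).locallyIntegrable Fact.out) ((Lp.memLp g).locallyIntegrable Fact.out) h)

theorem integral_smul_shift (φ : ℝ → ℝ) (t : ℝ) (f : LpReal p) :
    ∫ x, φ x • shift p t f x = ∫ x, φ (x + t) • f x := by
  rw [← integral_sub_right_eq_self (fun x => φ (x + t) • f x) t]
  refine integral_congr_ae ?_
  filter_upwards [coeFn_shift p t f] with x hx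
  simp [hx]

theorem hasDerivAt_integral_smul_shift (f : LpReal p) {φ : ℝ → ℝ} (hφ : ContDiff ℝ ∞ φ)
    (hc : HasCompactSupport φ) (t : ℝ) :
    HasDerivAt (fun s => ∫ x, φ x • shift p s f x) (∫ x, deriv φ x • shift p t f x) t := by
  simp_rw [integral_smul_shift]
  have hloc : LocallyIntegrable f := (Lp.memLp f).locallyIntegrable Fact.out
  have hφ' : Continuous (deriv φ) := hφ.continuous_deriv (by simp)
  obtain ⟨M, hM⟩ := hc.deriv.exists_bound_of_continuous hφ'
  obtain ⟨R, hR⟩ := hc.deriv.isCompact.isBounded.subset_closedBall 0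
  have hsub : ∀ s, HasCompactSupport fun x => φ (x + s) := fun s =>
    hc.comp_homeomorph (Homeomorph.addRight s)
  have hM0 : 0 ≤ M := (norm_nonneg _).trans (hM 0)
  -- For `|s - t| < 1` the support of `φ'(· + s)` stays in the ball of radius `R + |t| + 1`, on
  -- which `f` is integrable.
  refine (hasDerivAt_integral_of_dominated_loc_of_deriv_le (s := Metric.ball t 1)
    (F := fun s x => φ (x + s) • f x) (F' := fun s x => deriv φ (x + s) • f x)
    (bound := (Metric.closedBall (0 : ℝ) (R + |t| + 1)).indicator fun x => M * ‖f x‖)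
    (Metric.ball_mem_nhds t one_pos) ?_ ?_ ?_ ?_ ?_ ?_).2
  · exact .of_forall fun s => (integrable_smul_Lp f (hφ.continuous.comp (by fun_prop))
      (hsub s)).aestronglyMeasurable
  · exact integrable_smul_Lp f (hφ.continuous.comp (by fun_prop)) (hsub t)
  · exact (hφ'.comp (continuous_id.add continuous_const)).aestronglyMeasurable.smul
      (Lp.aestronglyMeasurable f)
  · refine .of_forall fun x s hs => ?_
    by_cases hx : deriv φ (x + s) = 0
    · simp only [hx, zero_smul, norm_zero]
      exact indicator_nonneg (fun y _ => by positivity) x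
    · have h1 : x + s ∈ Metric.closedBall (0 : ℝ) R := hR (subset_tsupport _ hx)
      have h2 : x ∈ Metric.closedBall (0 : ℝ) (R + |t| + 1) := by
        simp only [Metric.mem_closedBall, Metric.mem_ball, dist_zero_right, Real.norm_eq_abs,
          Real.dist_eq] at h1 hs ⊢
        have := abs_sub_abs_le_abs_sub s t
        have := abs_sub_abs_le_abs_sub x (-s)
        rw [abs_neg, sub_neg_eq_add] at this
        linarith
      rw [indicator_of_mem h2, norm_smul]
      exact mul_le_mul_of_nonneg_right (hM _) (norm_nonneg _)
  · rw [integrable_indicator_iff measurableSet_closedBall]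
    exact ((hloc.integrableOn_isCompact (isCompact_closedBall _ _)).norm).const_mul M
  · refine .of_forall fun x s _ => ?_
    have : HasDerivAt φ (deriv φ (x + s)) (x + s) :=
      (hφ.differentiable (by simp) _).hasDerivAt
    exact (this.comp_const_add x s).smul_const (f x)

theorem IsWeakDeriv.shift {f g : LpReal p} (h : IsWeakDeriv f g) (t : ℝ) :
    IsWeakDeriv (shift p t f) (InverseGenerator.shift p t g) := by
  intro φ hφ hc
  have hd : ∀ x, deriv φ (x + t) = deriv (fun y => φ (y + t)) x := fun x =>
    (deriv_comp_add_const φ t x).symm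
  rw [integral_smul_shift, integral_smul_shift]
  simp_rw [hd]
  exact h _ (hφ.comp (contDiff_id.add contDiff_const)) (hc.comp_homeomorph (Homeomorph.addRight t))

theorem mem_graph_shiftGenerator_iff {f g : LpReal p} :
    (f, g) ∈ (shiftGenerator p).graph ↔ IsWeakDeriv f (-g) := by
  rw [LinearPMap.mem_graph_iff]
  constructor
  · rintro ⟨y, rfl, rfl⟩
    have : shiftGenerator p y = -weakDeriv y := rfl
    rw [this, neg_neg]
    exact isWeakDeriv_weakDeriv y
  · intro h
    refine ⟨⟨f, -g, h⟩, rfl, ?_⟩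
    have : shiftGenerator p ⟨f, -g, h⟩ = -weakDeriv ⟨f, -g, h⟩ := rfl
    change shiftGenerator p ⟨f, -g, h⟩ = g
    rw [this, (isWeakDeriv_weakDeriv ⟨f, -g, h⟩).unique h, neg_neg]

theorem intervalIntegrable_shift (hp : p ≠ ⊤) (f : LpReal p) (a b : ℝ) :
    IntervalIntegrable (fun s => shift p s f) volume a b :=
  (continuous_shift hp f).intervalIntegrable a b

theorem integral_smul_integral_shift (hp : p ≠ ⊤) (f : LpReal p) {φ : ℝ → ℝ}
    (hφ : Continuous φ) (hc : HasCompactSupport φ) (t : ℝ) :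
    ∫ x, φ x • (∫ s in (0 : ℝ)..t, shift p s f) x =
      ∫ s in (0 : ℝ)..t, ∫ x, φ x • shift p s f x := by
  obtain ⟨L, hL⟩ := exists_clm_eq_integral_smul (p := p) hφ hc
  simp_rw [← hL]
  exact (L.intervalIntegral_comp_comm (intervalIntegrable_shift hp f 0 t)).symm

theorem integral_smul_sub (f g : LpReal p) {φ : ℝ → ℝ} (hφ : Continuous φ)
    (hc : HasCompactSupport φ) :
    ∫ x, φ x • (f - g) x = (∫ x, φ x • f x) - ∫ x, φ x • g x := by
  obtain ⟨L, hL⟩ := exists_clm_eq_integral_smul (p := p) hφ hc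
  simp_rw [← hL, map_sub]

theorem integral_integral_deriv_smul_shift (hp : p ≠ ⊤) (f : LpReal p) {φ : ℝ → ℝ}
    (hφ : ContDiff ℝ ∞ φ) (hc : HasCompactSupport φ) (t : ℝ) :
    ∫ s in (0 : ℝ)..t, ∫ x, deriv φ x • shift p s f x = ∫ x, φ x • (shift p t f - f) x := by
  have hcont : Continuous fun s => ∫ x, deriv φ x • shift p s f x := by
    obtain ⟨L, hL⟩ := exists_clm_eq_integral_smul (p := p)
      (hφ.continuous_deriv (by simp)) hc.deriv
    simp_rw [← hL]
    exact L.continuous.comp (continuous_shift hp f)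
  rw [intervalIntegral.integral_eq_sub_of_hasDerivAt
    (fun s _ => hasDerivAt_integral_smul_shift f hφ hc s) (hcont.intervalIntegrable 0 t),
    integral_smul_sub _ _ hφ.continuous hc, shift_zero, ContinuousLinearMap.id_apply]

/-- The primitive of the shift orbit lies in the domain of the generator. -/
theorem isWeakDeriv_integral_shift (hp : p ≠ ⊤) (f : LpReal p) (t : ℝ) :
    IsWeakDeriv (∫ s in (0 : ℝ)..t, shift p s f) (-(shift p t f - f)) := by
  intro φ hφ hc
  rw [integral_smul_integral_shift hp f (hφ.continuous_deriv (by simp)) hc.deriv,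
    integral_integral_deriv_smul_shift hp f hφ hc, neg_sub,
    integral_smul_sub _ _ hφ.continuous hc, integral_smul_sub _ _ hφ.continuous hc, neg_sub]

/-- The fundamental theorem of calculus, tested against `φ`: the pairing of `φ` with `S(s)f` has
derivative `∫ φ' S(s)f`, which is `∫ φ S(s)g` because weak derivatives commute with shifts. -/
theorem IsWeakDeriv.shift_sub_eq_integral (hp : p ≠ ⊤) {f g : LpReal p}
    (h : IsWeakDeriv f (-g)) (t : ℝ) :
    InverseGenerator.shift p t f - f = ∫ s in (0 : ℝ)..t, InverseGenerator.shift p s g := by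
  refine eq_of_forall_integral_smul_eq fun φ hφ hc => ?_
  rw [integral_smul_integral_shift hp g hφ.continuous hc,
    ← integral_integral_deriv_smul_shift hp f hφ hc]
  refine intervalIntegral.integral_congr fun s _ => ?_
  have := (h.shift s) φ hφ hc
  obtain ⟨L, hL⟩ := exists_clm_eq_integral_smul (p := p) hφ.continuous hc
  simp only [← hL, map_neg, neg_neg] at this ⊢
  exact this

theorem IsWeakDeriv.tendsto_shift (hp : p ≠ ⊤) {f g : LpReal p} (h : IsWeakDeriv f (-g)) :
    Tendsto (fun t : ℝ => (t : ℂ)⁻¹ • (InverseGenerator.shift p t f - f)) (𝓝[≠] 0) (𝓝 g) := by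
  have hd : HasDerivAt (fun t => ∫ s in (0 : ℝ)..t, InverseGenerator.shift p s g) g 0 := by
    have := intervalIntegral.integral_hasDerivAt_right (intervalIntegrable_shift hp g 0 0)
      ((continuous_shift hp g).stronglyMeasurableAtFilter _ _) (continuous_shift hp g).continuousAt
    rwa [shift_zero] at this
  refine (hasDerivAt_iff_tendsto_slope.mp hd).congr fun t => ?_
  rw [slope_def_module, intervalIntegral.integral_same, sub_zero, sub_zero,
    ← h.shift_sub_eq_integral hp, ← Complex.ofReal_inv]
  exact (Complex.coe_smul _ _).symm

/-- Norm convergence passes to pairings, whose limit is known. The free filter `l` serves both the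
two-sided limit of the group and the one-sided limit of the semigroup. -/
theorem isWeakDeriv_of_tendsto_shift {f g : LpReal p} {l : Filter ℝ} [l.NeBot]
    (hl : l ≤ 𝓝[≠] 0)
    (h : Tendsto (fun t : ℝ => (t : ℂ)⁻¹ • (shift p t f - f)) l (𝓝 g)) :
    IsWeakDeriv f (-g) := by
  intro φ hφ hc
  obtain ⟨L, hL⟩ := exists_clm_eq_integral_smul (p := p) hφ.continuous hc
  have h1 := (L.continuous.tendsto g).comp h
  have hd := hasDerivAt_integral_smul_shift f hφ hc 0
  have h2 := (hasDerivAt_iff_tendsto_slope.mp hd).mono_left hl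
  simp only [shift_zero, ContinuousLinearMap.id_apply] at h2
  have h3 := tendsto_nhds_unique_of_eventuallyEq h1 h2 (.of_forall fun t => by
    rw [Function.comp_apply, map_smul, map_sub, hL, hL, slope_def_module, sub_zero, shift_zero,
      ContinuousLinearMap.id_apply, ← Complex.ofReal_inv]
    exact Complex.coe_smul t⁻¹ (_ : ℂ))
  rw [← h3, ← hL, map_neg, neg_neg]

theorem tendsto_coe_nhdsGT_zero :
    Tendsto ((↑) : ℝ≥0 → ℝ) (𝓝[>] 0) (𝓝[>] (0 : ℝ)) :=
  tendsto_nhdsWithin_iff.mpr ⟨NNReal.continuous_coe.tendsto' _ _ NNReal.coe_zero |>.mono_left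
    nhdsWithin_le_nhds, eventually_nhdsWithin_of_forall fun t ht => by simpa using ht⟩

theorem map_coe_nhdsGT_zero_le : Filter.map ((↑) : ℝ≥0 → ℝ) (𝓝[>] 0) ≤ 𝓝[≠] (0 : ℝ) :=
  tendsto_coe_nhdsGT_zero.mono_right (nhdsWithin_mono _ fun _ hx => ne_of_gt hx)

theorem isGroupGenerator_shift (hp : p ≠ ⊤) :
    IsGroupGenerator (shiftGenerator p) (shift p) := fun _ _ =>
  mem_graph_shiftGenerator_iff.trans
    ⟨fun h => h.tendsto_shift hp, fun h => isWeakDeriv_of_tendsto_shift le_rfl h⟩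

theorem isSemigroupGenerator_shift (hp : p ≠ ⊤) :
    IsSemigroupGenerator (shiftGenerator p) (fun t : ℝ≥0 => shift p (t : ℝ)) := fun _ _ =>
  mem_graph_shiftGenerator_iff.trans
    ⟨fun h => (h.tendsto_shift hp).comp map_coe_nhdsGT_zero_le,
      fun h => isWeakDeriv_of_tendsto_shift map_coe_nhdsGT_zero_le (tendsto_map'_iff.mpr h)⟩

end ShiftGroup

/-! ### Cesàro means: injectivity and dense range -/

section MeanErgodic

theorem Lp_coeFn_sum {p : ℝ≥0∞} {ι : Type*} (s : Finset ι) (f : ι → LpReal p) :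
    ⇑(∑ i ∈ s, f i) =ᵐ[volume] fun x => ∑ i ∈ s, f i x := by
  classical
  induction s using Finset.induction_on with
  | empty => exact Lp.coeFn_zero ℂ p volume
  | insert a s ha ih =>
    rw [Finset.sum_insert ha]
    filter_upwards [Lp.coeFn_add (f a) (∑ i ∈ s, f i), ih] with x h₁ h₂
    rw [h₁, Pi.add_apply, h₂, Finset.sum_insert ha]

variable {p : ℝ≥0∞} [Fact (1 ≤ p)]

/-- The Cesàro means of the powers of the shift by `K`. -/
noncomputable def shiftMean (p : ℝ≥0∞) [Fact (1 ≤ p)] (K : ℝ) (N : ℕ) (f : LpReal p) : LpReal p :=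
  (N : ℂ)⁻¹ • ∑ n ∈ Finset.range N, shift p (K * n) f

theorem shiftMean_sub (K : ℝ) (N : ℕ) (f g : LpReal p) :
    shiftMean p K N (f - g) = shiftMean p K N f - shiftMean p K N g := by
  simp [shiftMean, smul_sub]

theorem norm_shiftMean_le (K : ℝ) (N : ℕ) (f : LpReal p) : ‖shiftMean p K N f‖ ≤ ‖f‖ := by
  rw [shiftMean, norm_smul, norm_inv, Complex.norm_natCast]
  have h : ‖∑ n ∈ Finset.range N, shift p (K * n) f‖ ≤ N * ‖f‖ :=
    (norm_sum_le _ _).trans (by simp [norm_shift])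
  rcases Nat.eq_zero_or_pos N with rfl | hN
  · simp
  · rw [inv_mul_le_iff₀ (by positivity)]
    exact h

/-- The step `2R + 1` exceeds the diameter `2R` of the support, so at most one summand is nonzero at
each point and the bound does not grow with `N`. -/
theorem norm_sum_translates_le {φ : ℝ → ℂ} {M R : ℝ} (hM : ∀ x, ‖φ x‖ ≤ M)
    (hR : ∀ x, φ x ≠ 0 → |x| ≤ R) (hR0 : 0 ≤ R) (N : ℕ) (x : ℝ) :
    ‖∑ n ∈ Finset.range N, φ (x - (2 * R + 1) * n)‖ ≤
      (Icc (-R) (R + (2 * R + 1) * N)).indicator (fun _ => M) x := by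
  have hM0 : 0 ≤ M := (norm_nonneg _).trans (hM 0)
  by_cases h : ∃ n ∈ Finset.range N, φ (x - (2 * R + 1) * n) ≠ 0
  · obtain ⟨n, hn, hne⟩ := h
    have h1 := abs_le.mp (hR _ hne)
    have hnN : (n : ℝ) ≤ N := by exact_mod_cast (Finset.mem_range.mp hn).le
    have hn0 : (0 : ℝ) ≤ n := n.cast_nonneg
    rw [Finset.sum_eq_single_of_mem n hn, indicator_of_mem]
    · exact hM _
    · constructor <;> nlinarith
    · intro m _ hmn
      by_contra h0
      have h2 := abs_le.mp (hR _ h0)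
      rcases lt_or_gt_of_ne hmn with hlt | hlt
      · have : (m : ℝ) + 1 ≤ n := by exact_mod_cast hlt
        nlinarith
      · have : (n : ℝ) + 1 ≤ m := by exact_mod_cast hlt
        nlinarith
  · push Not at h
    rw [Finset.sum_eq_zero h, norm_zero]
    exact indicator_nonneg (fun _ _ => hM0) x

/-- Disjoint translates make the norm of the sum grow only like `N^(1/p)`; after division by `N` it
tends to zero exactly because `p > 1`. -/
theorem norm_shiftMean_toLp_le {φ : ℝ → ℂ} (hφ : MemLp φ p) {M R : ℝ} (hM : ∀ x, ‖φ x‖ ≤ M)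
    (hR : ∀ x, φ x ≠ 0 → |x| ≤ R) (hR0 : 0 ≤ R) (hp : p ≠ ⊤) (N : ℕ) :
    ‖shiftMean p (2 * R + 1) N (hφ.toLp φ)‖ ≤
      (N : ℝ)⁻¹ * (M * (2 * R + (2 * R + 1) * N) ^ (1 / p.toReal)) := by
  have hM0 : 0 ≤ M := (norm_nonneg _).trans (hM 0)
  rw [shiftMean, norm_smul, norm_inv, Complex.norm_natCast]
  refine mul_le_mul_of_nonneg_left ?_ (by positivity)
  have hv : volume (Icc (-R) (R + (2 * R + 1) * N)) ≠ ⊤ := measure_Icc_lt_top.ne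
  have hn := norm_indicatorConstLp (p := p) (hs := measurableSet_Icc) (hμs := hv) (c := (M : ℂ))
    (zero_lt_one.trans_le Fact.out).ne' hp
  have hN : 0 ≤ (2 * R + 1) * N := by positivity
  rw [Real.volume_real_Icc_of_le (by linarith), Complex.norm_real, Real.norm_of_nonneg hM0] at hn
  rw [show 2 * R + (2 * R + 1) * N = R + (2 * R + 1) * N - -R by ring, ← hn]
  refine Lp.norm_le_norm_of_ae_le ?_
  have hsh : ∀ᵐ x, ∀ n : ℕ, shift p ((2 * R + 1) * n) (hφ.toLp φ) x = φ (x - (2 * R + 1) * n) := by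
    refine ae_all_iff.mpr fun n => ?_
    filter_upwards [coeFn_shift p ((2 * R + 1) * n) (hφ.toLp φ),
      (measurePreserving_sub_right volume ((2 * R + 1) * (n : ℝ))).quasiMeasurePreserving.ae
        hφ.coeFn_toLp] with x h₁ h₂
    rw [h₁, h₂]
  filter_upwards [Lp_coeFn_sum (Finset.range N) fun n => shift p ((2 * R + 1) * n) (hφ.toLp φ),
    hsh, indicatorConstLp_coeFn (p := p) (hs := measurableSet_Icc) (hμs := hv) (c := (M : ℂ))]
    with x h₁ h₂ h₃
  rw [h₁, h₃, Finset.sum_congr rfl fun n _ => h₂ n, norm_indicator_eq_indicator_norm,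
    Complex.norm_real, Real.norm_of_nonneg hM0]
  exact norm_sum_translates_le hM hR hR0 N x

theorem tendsto_inv_mul_rpow {r : ℝ} (hr0 : 0 ≤ r) (hr : r < 1) {M a b : ℝ} (ha : 0 ≤ a)
    (hb : 0 ≤ b) :
    Tendsto (fun N : ℕ => (N : ℝ)⁻¹ * (M * (a + b * N) ^ r)) atTop (𝓝 0) := by
  have h1 : Tendsto (fun N : ℕ => (N : ℝ) ^ (-(1 - r))) atTop (𝓝 0) :=
    (tendsto_rpow_neg_atTop (by linarith)).comp tendsto_natCast_atTop_atTop
  have h2 : Tendsto (fun N : ℕ => (N : ℝ)⁻¹) atTop (𝓝 0) := tendsto_inv_atTop_nhds_zero_nat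
  have h3 : Tendsto (fun N : ℕ => (N : ℝ) ^ (-(1 - r)) * (M * (a * (N : ℝ)⁻¹ + b) ^ r))
      atTop (𝓝 0) := by
    have := h1.mul (((h2.const_mul a).add_const b).rpow_const (p := r) (.inr hr0) |>.const_mul M)
    simpa using this
  refine h3.congr' ?_
  filter_upwards [eventually_gt_atTop 0] with N hN
  have hN' : (0 : ℝ) < N := by exact_mod_cast hN
  have e : a + b * N = (a * (N : ℝ)⁻¹ + b) * N := by field_simp
  have e2 : (N : ℝ) ^ (-(1 - r)) = (N : ℝ)⁻¹ * (N : ℝ) ^ r := by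
    rw [neg_sub, Real.rpow_sub hN', Real.rpow_one]; field_simp
  rw [e, Real.mul_rpow (by positivity) hN'.le, e2]
  ring

/-- Suitable Cesàro means of an orbit of the shift on `L^p(ℝ)`, `1 < p < ∞`, are small. -/
theorem exists_norm_shiftMean_lt (hp1 : 1 < p) (hp : p ≠ ⊤) (f : LpReal p) {ε : ℝ} (hε : 0 < ε) :
    ∃ (K : ℝ) (N : ℕ), 0 < N ∧ ‖shiftMean p K N f‖ < ε := by
  obtain ⟨φ, hc, hφε, hcont, hφ⟩ := (Lp.memLp f).exists_hasCompactSupport_eLpNorm_sub_le hp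
    (ε := ENNReal.ofReal (ε / 2)) (by simpa using hε)
  obtain ⟨M, hM⟩ := hc.exists_bound_of_continuous hcont
  obtain ⟨R, hR⟩ := hc.isCompact.isBounded.subset_closedBall 0
  have hR' : ∀ x, φ x ≠ 0 → |x| ≤ max R 0 := fun x hx => by
    have := hR (subset_tsupport _ hx)
    rw [Metric.mem_closedBall, dist_zero_right, Real.norm_eq_abs] at this
    exact this.trans (le_max_left _ _)
  have hp1' : 1 < p.toReal := by
    simpa using (ENNReal.toReal_lt_toReal ENNReal.one_ne_top hp).mpr hp1
  have hlim := tendsto_inv_mul_rpow (r := 1 / p.toReal) (by positivity)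
    (by rw [div_lt_one (by linarith)]; exact hp1') (M := M) (a := 2 * max R 0)
    (b := 2 * max R 0 + 1) (by positivity) (by positivity)
  obtain ⟨N, hN, hN0⟩ := ((hlim.eventually_lt_const (half_pos hε)).and
    (eventually_gt_atTop 0)).exists
  refine ⟨2 * max R 0 + 1, N, hN0, ?_⟩
  have h1 := norm_shiftMean_toLp_le hφ hM hR' (le_max_right _ _) hp N
  have h2 := norm_shiftMean_le (2 * max R 0 + 1) N (f - hφ.toLp φ)
  have h3 : ‖f - hφ.toLp φ‖ ≤ ε / 2 := by
    rw [Lp.norm_def]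
    refine ENNReal.toReal_le_of_le_ofReal (by positivity) (le_trans (le_of_eq ?_) hφε)
    refine eLpNorm_congr_ae ?_
    filter_upwards [Lp.coeFn_sub f (hφ.toLp φ), hφ.coeFn_toLp] with x h h'
    rw [h, Pi.sub_apply, Pi.sub_apply, h']
  rw [shiftMean_sub] at h2
  -- The means are contractions, so replacing `f` by its compactly supported approximant costs at
  -- most `ε / 2`.
  have := norm_sub_norm_le (shiftMean p (2 * max R 0 + 1) N f)
    (shiftMean p (2 * max R 0 + 1) N (hφ.toLp φ))
  linarith

/-- A kernel element is fixed by all shifts, hence equals its own Cesàro means, which can be made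
arbitrarily small. -/
theorem shiftGenerator_ker (hp1 : 1 < p) (hp : p ≠ ⊤) :
    (shiftGenerator p).toFun.ker = ⊥ := by
  refine LinearMap.ker_eq_bot'.mpr fun f hf => ?_
  have hg : ((f : LpReal p), (0 : LpReal p)) ∈ (shiftGenerator p).graph :=
    LinearPMap.mem_graph_iff _ |>.mpr ⟨f, rfl, hf⟩
  rw [mem_graph_shiftGenerator_iff] at hg
  have hinv : ∀ t, shift p t f = f := fun t => by
    have := hg.shift_sub_eq_integral hp t
    simpa [sub_eq_zero] using this
  refine Subtype.ext (norm_le_zero_iff.mp (le_of_forall_pos_lt_add fun ε hε => ?_))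
  obtain ⟨K, N, hN, h⟩ := exists_norm_shiftMean_lt hp1 hp (f : LpReal p) hε
  have hN' : (N : ℂ) ≠ 0 := by exact_mod_cast hN.ne'
  have : shiftMean p K N (f : LpReal p) = f := by
    simp only [shiftMean, hinv, Finset.sum_const, Finset.card_range]
    rw [← Nat.cast_smul_eq_nsmul ℂ, inv_smul_smul₀ hN']
  rwa [this, ← zero_add ε] at h

theorem injective_shiftGenerator (hp1 : 1 < p) (hp : p ≠ ⊤) :
    Function.Injective (shiftGenerator p) :=
  LinearMap.ker_eq_bot.mp (shiftGenerator_ker hp1 hp)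

theorem shift_sub_mem_range (hp : p ≠ ⊤) (f : LpReal p) (t : ℝ) :
    shift p t f - f ∈ LinearMap.range (shiftGenerator p).toFun := by
  obtain ⟨y, -, hy⟩ := (LinearPMap.mem_graph_iff _).mp
    (mem_graph_shiftGenerator_iff.mpr (isWeakDeriv_integral_shift hp f t))
  exact ⟨y, hy⟩

theorem dense_range_shiftGenerator (hp1 : 1 < p) (hp : p ≠ ⊤) :
    Dense (Set.range (shiftGenerator p)) := by
  refine Metric.dense_iff.mpr fun f ε hε => ?_
  obtain ⟨K, N, hN, h⟩ := exists_norm_shiftMean_lt hp1 hp f hε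
  have hN' : (N : ℂ) ≠ 0 := by exact_mod_cast hN.ne'
  refine ⟨f - shiftMean p K N f, ?_, ?_⟩
  · rwa [Metric.mem_ball, dist_eq_norm, sub_sub_cancel_left, norm_neg]
  -- The error `f - shiftMean p K N f` is minus an average of vectors `S(t)f - f`, each the image
  -- under `A` of an orbit integral.
  · have : f - shiftMean p K N f =
        -((N : ℂ)⁻¹ • ∑ n ∈ Finset.range N, (shift p (K * n) f - f)) := by
      rw [shiftMean, Finset.sum_sub_distrib, Finset.sum_const, Finset.card_range, smul_sub,
        ← Nat.cast_smul_eq_nsmul ℂ, inv_smul_smul₀ hN', neg_sub]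
    rw [this]
    exact Submodule.neg_mem _ (Submodule.smul_mem _ _
      (Submodule.sum_mem _ fun n _ => shift_sub_mem_range hp f _))

theorem mem_graph_inverse_iff (hp1 : 1 < p) (hp : p ≠ ⊤) {f g : LpReal p} :
    (f, g) ∈ (shiftGenerator p).inverse.graph ↔ (g, f) ∈ (shiftGenerator p).graph := by
  rw [LinearPMap.inverse_graph (shiftGenerator_ker hp1 hp)]
  simp

end MeanErgodic

/-- Dominated convergence to zero in the `L^p` seminorm. -/
theorem tendsto_eLpNorm_zero_of_dominated {α ι E : Type*} [MeasurableSpace α] {μ : Measure α}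
    [NormedAddCommGroup E] {p : ℝ≥0∞} (hp0 : p ≠ 0) (hp : p ≠ ⊤) {l : Filter ι}
    [l.IsCountablyGenerated] {F : ι → α → E} {G : α → ℝ} (hG : MemLp G p μ)
    (hF : ∀ᶠ i in l, AEStronglyMeasurable (F i) μ)
    (hb : ∀ᶠ i in l, ∀ᵐ x ∂μ, ‖F i x‖ ≤ ‖G x‖)
    (hlim : ∀ᵐ x ∂μ, Tendsto (fun i => F i x) l (𝓝 0)) :
    Tendsto (fun i => eLpNorm (F i) p μ) l (𝓝 0) := by
  have hpos : 0 < p.toReal := ENNReal.toReal_pos hp0 hp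
  simp_rw [eLpNorm_eq_lintegral_rpow_enorm_toReal hp0 hp]
  have key : Tendsto (fun i => ∫⁻ x, ‖F i x‖ₑ ^ p.toReal ∂μ) l (𝓝 (∫⁻ _, 0 ∂μ)) := by
    refine tendsto_lintegral_filter_of_dominated_convergence' (fun x => ‖G x‖ₑ ^ p.toReal)
      (hF.mono fun i hi => hi.enorm.pow_const _) ?_
      (lintegral_rpow_enorm_lt_top_of_eLpNorm_lt_top hp0 hp hG.2).ne ?_
    · exact hb.mono fun i hi => hi.mono fun x hx =>
        ENNReal.rpow_le_rpow (enorm_le_iff_norm_le.mpr hx) hpos.le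
    · filter_upwards [hlim] with x hx
      have := (continuous_enorm.tendsto (0 : E)).comp hx
      simpa [Function.comp_def, hpos] using this.ennrpow_const p.toReal
  rw [lintegral_zero] at key
  simpa [hpos] using key.ennrpow_const (1 / p.toReal)

/-- Dominated convergence in `L^p(ℝ)`. -/
theorem tendsto_Lp_of_dominated {ι : Type*} {p : ℝ≥0∞} [Fact (1 ≤ p)] (hp : p ≠ ⊤)
    {l : Filter ι} [l.IsCountablyGenerated] {F : ι → LpReal p} {f : LpReal p} {u : ι → ℝ → ℂ}
    {v : ℝ → ℂ} {G : ℝ → ℝ} (hG : MemLp G p) (hF : ∀ i, F i =ᵐ[volume] u i)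
    (hf : f =ᵐ[volume] v) (hb : ∀ᶠ i in l, ∀ᵐ x, ‖u i x - v x‖ ≤ ‖G x‖)
    (hlim : ∀ᵐ x, Tendsto (fun i => u i x) l (𝓝 (v x))) : Tendsto F l (𝓝 f) := by
  refine (Lp.tendsto_Lp_iff_tendsto_eLpNorm' _ _).mpr ?_
  have : ∀ i, eLpNorm (⇑(F i) - ⇑f) p volume = eLpNorm (fun x => u i x - v x) p volume :=
    fun i => eLpNorm_congr_ae ((hF i).sub hf)
  simp_rw [this]
  refine tendsto_eLpNorm_zero_of_dominated (zero_lt_one.trans_le Fact.out).ne' hp hG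
    (.of_forall fun i => ?_) hb (hlim.mono fun x hx => tendsto_sub_nhds_zero_iff.mpr hx)
  exact ((Lp.aestronglyMeasurable (F i)).congr (hF i)).sub
    ((Lp.aestronglyMeasurable f).congr hf)

/-! ### Unimodular multiplication groups on `L²` -/

section MultiplicationGroup

theorem memLp_top_cexp_mul_I {m : ℝ → ℝ} (hm : Measurable m) (t : ℝ) :
    MemLp (fun x => Complex.exp ((t * m x : ℝ) * Complex.I)) ⊤ (volume : Measure ℝ) :=
  memLp_top_of_bound (by fun_prop) 1 (.of_forall fun x => (Complex.norm_exp_ofReal_mul_I _).le)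

/-- Multiplication by `exp(i t m)` on `L²(ℝ)`. -/
noncomputable def expMul {m : ℝ → ℝ} (hm : Measurable m) (t : ℝ) : LpReal 2 →L[ℂ] LpReal 2 :=
  (ContinuousLinearMap.mul ℂ ℂ).holderL volume ⊤ 2 2 ((memLp_top_cexp_mul_I hm t).toLp _)

theorem coeFn_expMul {m : ℝ → ℝ} (hm : Measurable m) (t : ℝ) (f : LpReal 2) :
    expMul hm t f =ᵐ[volume] fun x => Complex.exp ((t * m x : ℝ) * Complex.I) * f x := by
  have h := (ContinuousLinearMap.mul ℂ ℂ).coeFn_holder (r := 2)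
    ((memLp_top_cexp_mul_I hm t).toLp _) f
  filter_upwards [h, (memLp_top_cexp_mul_I hm t).coeFn_toLp] with x h₁ h₂
  change (ContinuousLinearMap.mul ℂ ℂ).holder 2 _ f x = _
  rw [h₁, h₂]
  rfl

variable {m : ℝ → ℝ} (hm : Measurable m)

theorem expMul_zero : expMul hm 0 = ContinuousLinearMap.id ℂ (LpReal 2) := by
  ext1 f
  refine Lp.ext ?_
  filter_upwards [coeFn_expMul hm 0 f] with x hx
  simpa using hx

theorem expMul_add (s t : ℝ) : expMul hm (s + t) = (expMul hm s).comp (expMul hm t) := by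
  ext1 f
  refine Lp.ext ?_
  filter_upwards [coeFn_expMul hm (s + t) f, coeFn_expMul hm s (expMul hm t f),
    coeFn_expMul hm t f] with x h₁ h₂ h₃
  rw [h₁, ContinuousLinearMap.comp_apply, h₂, h₃, ← mul_assoc, ← Complex.exp_add]
  congr 2
  push_cast
  ring

theorem continuous_expMul (f : LpReal 2) : Continuous fun t => expMul hm t f := by
  refine continuous_iff_continuousAt.mpr fun t => ?_
  refine tendsto_Lp_of_dominated (by simp) ((Lp.memLp f).norm.const_mul 2)
    (fun s => coeFn_expMul hm s f) (coeFn_expMul hm t f) ?_ ?_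
  · refine .of_forall fun s => .of_forall fun x => ?_
    rw [← sub_mul, norm_mul, norm_mul, norm_norm, Real.norm_ofNat]
    gcongr
    refine (norm_sub_le _ _).trans (le_of_eq ?_)
    rw [Complex.norm_exp_ofReal_mul_I, Complex.norm_exp_ofReal_mul_I]
    norm_num
  · refine .of_forall fun x => ?_
    have : Continuous fun s : ℝ => Complex.exp ((s * m x : ℝ) * Complex.I) * f x := by fun_prop
    exact this.tendsto t

theorem coeFn_inv_smul_expMul_sub (t : ℝ) (f : LpReal 2) :
    ⇑((t : ℂ)⁻¹ • (expMul hm t f - f)) =ᵐ[volume] fun x =>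
      (t : ℂ)⁻¹ * (Complex.exp ((t * m x : ℝ) * Complex.I) - 1) * f x := by
  filter_upwards [Lp.coeFn_smul (t : ℂ)⁻¹ (expMul hm t f - f), Lp.coeFn_sub (expMul hm t f) f,
    coeFn_expMul hm t f] with x h₁ h₂ h₃
  rw [h₁, Pi.smul_apply, h₂, Pi.sub_apply, h₃, smul_eq_mul]
  ring

theorem tendsto_inv_mul_cexp_sub_one (a : ℝ) :
    Tendsto (fun t : ℝ => (t : ℂ)⁻¹ * (Complex.exp ((t * a : ℝ) * Complex.I) - 1)) (𝓝[≠] 0)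
      (𝓝 (a * Complex.I)) := by
  have h : HasDerivAt (fun t : ℝ => Complex.exp ((t * a : ℝ) * Complex.I)) (a * Complex.I) 0 := by
    have h1 : HasDerivAt (fun t : ℝ => ((t * a : ℝ) : ℂ) * Complex.I) (a * Complex.I) 0 := by
      simpa using ((hasDerivAt_id (0 : ℝ)).mul_const a).ofReal_comp.mul_const Complex.I
    simpa using h1.cexp
  refine (hasDerivAt_iff_tendsto_slope.mp h).congr fun t => ?_
  simp [slope_def_module]

/-- The generator of the group of multiplications by `exp(i t m)` is multiplication by `i m`. -/
theorem tendsto_expMul_iff {l : Filter ℝ} [l.NeBot] [l.IsCountablyGenerated] (hl : l ≤ 𝓝[≠] 0)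
    (f g : LpReal 2) :
    Tendsto (fun t : ℝ => (t : ℂ)⁻¹ • (expMul hm t f - f)) l (𝓝 g) ↔
      g =ᵐ[volume] fun x => m x * Complex.I * f x := by
  constructor
  · intro h
    -- Norm convergence gives almost everywhere convergence along a sequence, enough to identify the
    -- limit pointwise.
    obtain ⟨ns, hns, hlim⟩ := (tendstoInMeasure_of_tendsto_Lp h).exists_seq_tendsto_ae'
    filter_upwards [hlim, ae_all_iff.mpr fun n => coeFn_inv_smul_expMul_sub hm (ns n) f]
      with x hx hx'
    refine tendsto_nhds_unique hx (Tendsto.congr (fun n => (hx' n).symm) ?_)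
    exact (((tendsto_inv_mul_cexp_sub_one (m x)).comp (hns.mono_right hl)).mul_const (f x))
  · intro h
    -- Since `|exp(ita) - 1| ≤ |ta|`, the quotients are bounded by `|m f| = |g|`, and their distance
    -- to `g` by `2|g|`.
    refine tendsto_Lp_of_dominated (by simp) ((Lp.memLp g).norm.const_mul 2)
      (fun t => coeFn_inv_smul_expMul_sub hm t f) h ?_ ?_
    · refine .of_forall fun t => ?_
      filter_upwards [h] with x hx
      rw [norm_mul, norm_norm, Real.norm_ofNat, two_mul]
      refine (norm_sub_le _ _).trans (add_le_add ?_ (by rw [hx]))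
      rw [hx, norm_mul, norm_mul (_ * _) (f x)]
      gcongr
      rw [norm_mul, norm_mul, Complex.norm_I, mul_one, norm_inv, Complex.norm_real,
        Complex.norm_real]
      rcases eq_or_ne t 0 with rfl | ht
      · simp
      rw [inv_mul_le_iff₀ (norm_pos_iff.mpr ht), mul_comm _ Complex.I, ← norm_mul]
      exact Real.norm_exp_I_mul_ofReal_sub_one_le
    · exact .of_forall fun x =>
        (((tendsto_inv_mul_cexp_sub_one (m x)).mono_left hl).mul_const (f x))

end MultiplicationGroup

/-! ### Fourier diagonalization: the case `p = 2` -/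

section Fourier

open scoped FourierTransform SchwartzMap

theorem measurable_neg_two_pi_mul : Measurable fun ξ : ℝ => -2 * Real.pi * ξ := by fun_prop

theorem measurable_inv_two_pi_mul : Measurable fun ξ : ℝ => (2 * Real.pi * ξ)⁻¹ := by fun_prop

theorem fourier_compSubConstCLM (f : 𝓢(ℝ, ℂ)) (t ξ : ℝ) :
    𝓕 (f.compSubConstCLM ℂ t) ξ =
      Complex.exp ((t * (-2 * Real.pi * ξ) : ℝ) * Complex.I) * 𝓕 f ξ := by
  rw [SchwartzMap.fourier_coe, SchwartzMap.fourier_coe, Real.fourier_real_eq_integral_exp_smul,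
    Real.fourier_real_eq_integral_exp_smul, ← integral_const_mul,
    ← integral_sub_right_eq_self (fun v => Complex.exp ((t * (-2 * Real.pi * ξ) : ℝ) * Complex.I) *
      Complex.exp ((-2 * Real.pi * v * ξ : ℝ) * Complex.I) • f v) t]
  refine integral_congr_ae (.of_forall fun v => ?_)
  simp only [SchwartzMap.compSubConstCLM_apply, smul_eq_mul]
  rw [← mul_assoc, ← Complex.exp_add]
  congr 2
  push_cast
  ring

/-- Both sides are continuous in `f`, so Schwartz functions suffice, where the transform is an
integral and the substitution is explicit. -/
theorem fourier_shift (t : ℝ) (f : LpReal 2) :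
    Lp.fourierTransformₗᵢ ℝ ℂ (shift 2 t f) =
      expMul measurable_neg_two_pi_mul t (Lp.fourierTransformₗᵢ ℝ ℂ f) := by
  refine DenseRange.induction_on (SchwartzMap.denseRange_toLpCLM (p := 2) ENNReal.ofNat_ne_top)
    (p := fun f : LpReal 2 => Lp.fourierTransformₗᵢ ℝ ℂ (shift 2 t f) =
      expMul measurable_neg_two_pi_mul t (Lp.fourierTransformₗᵢ ℝ ℂ f)) f ?_ ?_
  · exact isClosed_eq ((Lp.fourierTransformₗᵢ ℝ ℂ).continuous.comp (shift 2 t).continuous)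
      ((expMul measurable_neg_two_pi_mul t).continuous.comp
        (Lp.fourierTransformₗᵢ ℝ ℂ).continuous)
  · intro f
    have h1 : shift 2 t (f.toLp 2) = (f.compSubConstCLM ℂ t).toLp 2 := by
      refine Lp.ext ?_
      filter_upwards [coeFn_shift 2 t (f.toLp 2), (f.compSubConstCLM ℂ t).coeFn_toLp 2,
        (measurePreserving_sub_right volume t).quasiMeasurePreserving.ae
          (f.coeFn_toLp 2 volume)]
        with x h₁ h₂ h₃
      rw [h₁, h₂, h₃, SchwartzMap.compSubConstCLM_apply]
    have h2 : ∀ g : 𝓢(ℝ, ℂ), Lp.fourierTransformₗᵢ ℝ ℂ (g.toLp 2) = (𝓕 g).toLp 2 :=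
      fun g => SchwartzMap.toLp_fourier_eq g
    rw [SchwartzMap.toLpCLM_apply, h1, h2, h2]
    refine Lp.ext ?_
    filter_upwards [coeFn_expMul measurable_neg_two_pi_mul t ((𝓕 f).toLp 2),
      (𝓕 f).coeFn_toLp 2, (𝓕 (f.compSubConstCLM ℂ t)).coeFn_toLp 2] with x h₁ h₂ h₃
    rw [h₁, h₂, h₃, fourier_compSubConstCLM]

theorem mem_graph_shiftGenerator_two_iff {f g : LpReal 2} :
    (f, g) ∈ (shiftGenerator 2).graph ↔
      Lp.fourierTransformₗᵢ ℝ ℂ g =ᵐ[volume]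
        fun ξ => (-2 * Real.pi * ξ : ℝ) * Complex.I * Lp.fourierTransformₗᵢ ℝ ℂ f ξ := by
  rw [isGroupGenerator_shift (by simp) f g,
    ← tendsto_expMul_iff measurable_neg_two_pi_mul le_rfl]
  refine ((Lp.fourierTransformₗᵢ ℝ ℂ).toHomeomorph.isInducing.tendsto_nhds_iff).trans
    (tendsto_congr fun t => ?_)
  simp [fourier_shift]

/-- The symbols `-2πiξ` and `i/(2πξ)` are reciprocal away from the null set `ξ = 0`. -/
theorem mem_graph_inverse_two_iff {f g : LpReal 2} :
    (f, g) ∈ (shiftGenerator 2).inverse.graph ↔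
      Lp.fourierTransformₗᵢ ℝ ℂ g =ᵐ[volume]
        fun ξ => ((2 * Real.pi * ξ)⁻¹ : ℝ) * Complex.I * Lp.fourierTransformₗᵢ ℝ ℂ f ξ := by
  rw [mem_graph_inverse_iff (by simp) (by simp), mem_graph_shiftGenerator_two_iff]
  have h0 : ∀ᵐ ξ : ℝ, ξ ≠ 0 := Measure.ae_ne volume 0
  have key : ∀ (ξ : ℝ) (a b : ℂ), ξ ≠ 0 → (a = (-2 * Real.pi * ξ : ℝ) * Complex.I * b ↔
      b = ((2 * Real.pi * ξ)⁻¹ : ℝ) * Complex.I * a) := by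
    intro ξ a b hξ
    have h1 : (ξ : ℂ) ≠ 0 := by exact_mod_cast hξ
    have h2 : (Real.pi : ℂ) ≠ 0 := by exact_mod_cast Real.pi_ne_zero
    have h3 : ((-2 * Real.pi * ξ : ℝ) : ℂ) * Complex.I *
        (((2 * Real.pi * ξ)⁻¹ : ℝ) * Complex.I) = 1 := by
      push_cast
      field_simp
      linear_combination -Complex.I_sq
    constructor
    · rintro rfl
      linear_combination -b * h3
    · rintro rfl
      linear_combination -a * h3
  constructor
  · intro h
    filter_upwards [h, h0] with ξ h hξ using (key ξ _ _ hξ).mp h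
  · intro h
    filter_upwards [h, h0] with ξ h hξ using (key ξ _ _ hξ).mpr h

/-- On `L²(ℝ)` the inverse of the generator of the shift group generates a semigroup. -/
theorem generatesC0Semigroup_inverse_two :
    GeneratesC0Semigroup (shiftGenerator 2).inverse := by
  let F := (Lp.fourierTransformₗᵢ ℝ ℂ).toContinuousLinearEquiv
  have hF : ∀ f, F f = Lp.fourierTransformₗᵢ ℝ ℂ f := fun _ => rfl
  refine ⟨fun t => (F.symm : LpReal 2 →L[ℂ] LpReal 2) ∘L
    expMul measurable_inv_two_pi_mul (t : ℝ) ∘L (F : LpReal 2 →L[ℂ] LpReal 2), ⟨?_, ?_, ?_⟩, ?_⟩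
  · ext1 f
    simp [expMul_zero]
  · intro s t
    ext1 f
    simp [expMul_add]
  · intro f
    exact F.symm.continuous.comp
      ((continuous_expMul measurable_inv_two_pi_mul (F f)).comp NNReal.continuous_coe)
  · intro f g
    rw [mem_graph_inverse_two_iff, ← tendsto_expMul_iff measurable_inv_two_pi_mul
      map_coe_nhdsGT_zero_le, tendsto_map'_iff]
    refine Iff.trans (tendsto_congr fun t => ?_)
      (F.toHomeomorph.isInducing.tendsto_nhds_iff).symm
    simp [← hF]

end Fourier

/-! ### Uniqueness for the Cauchy problem -/

section Orbits

variable {X : Type*} [NormedAddCommGroup X] [NormedSpace ℂ X]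

theorem IsC0Semigroup.exists_norm_le [CompleteSpace X] {T : ℝ≥0 → X →L[ℂ] X}
    (hT : IsC0Semigroup T) (τ : ℝ≥0) : ∃ C, ∀ r ≤ τ, ‖T r‖ ≤ C := by
  obtain ⟨C, hC⟩ := banach_steinhaus (g := fun r : Iic τ => T r) fun x => by
    obtain ⟨C, hC⟩ := (isCompact_Icc (a := (0 : ℝ≥0)) (b := τ)).exists_bound_of_continuousOn
      (hT.continuous_orbit x).continuousOn
    exact ⟨C, fun r => hC r ⟨zero_le, r.2⟩⟩
  exact ⟨C, fun r hr => hC ⟨r, hr⟩⟩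

theorem tendsto_clm_apply_zero {ι : Type*} {l : Filter ι} {A : ι → X →L[ℂ] X} {v : ι → X} {C : ℝ}
    (hA : ∀ᶠ i in l, ‖A i‖ ≤ C) (hv : Tendsto v l (𝓝 0)) :
    Tendsto (fun i => A i (v i)) l (𝓝 0) := by
  refine squeeze_zero_norm' (hA.mono fun i hi => (A i).le_of_opNorm_le hi (v i)) ?_
  simpa using hv.norm.const_mul C

/-- Solutions of the Cauchy problem for the generator are orbits of the semigroup. -/
theorem IsC0Semigroup.apply_eq_of_hasDerivAt [CompleteSpace X] [NormedSpace ℝ X]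
    [IsScalarTower ℝ ℂ X] {T : ℝ≥0 → X →L[ℂ] X} (hT : IsC0Semigroup T) {B : X →ₗ.[ℂ] X}
    (hB : IsSemigroupGenerator B T) {w y : ℝ → X} (hw : ∀ t, HasDerivAt w (y t) t)
    (hg : ∀ t, (w t, y t) ∈ B.graph) (s : ℝ) (τ : ℝ≥0) : T τ (w s) = w (s + τ) := by
  obtain ⟨C, hC⟩ := hT.exists_norm_le τ
  have hle : ∀ r : ℝ, 0 ≤ r → (τ - r).toNNReal ≤ τ := fun r hr =>
    Real.toNNReal_le_iff_le_coe.mpr (by linarith)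
  -- This interpolates between `T τ (w s)` at `r = 0` and `w (s + τ)` at `r = τ`; it is constant
  -- because its right derivative vanishes.
  let h : ℝ → X := fun r => T (τ - r).toNNReal (w (s + r))
  have hwc : Continuous w := continuous_iff_continuousAt.mpr fun t => (hw t).continuousAt
  have hcont : ContinuousOn h (Icc 0 τ) := by
    intro r hr
    have h1 : Tendsto (fun r' : ℝ => T (τ - r').toNNReal (w (s + r') - w (s + r)))
        (𝓝[Icc 0 (τ : ℝ)] r) (𝓝 0) := by
      refine tendsto_clm_apply_zero (C := C)
        (eventually_nhdsWithin_of_forall fun r' hr' => hC _ (hle r' hr'.1)) ?_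
      refine tendsto_sub_nhds_zero_iff.mpr (Tendsto.mono_left ?_ nhdsWithin_le_nhds)
      exact (hwc.comp (continuous_const.add continuous_id)).tendsto r
    have h2 : Tendsto (fun r' : ℝ => T (τ - r').toNNReal (w (s + r)))
        (𝓝[Icc 0 (τ : ℝ)] r) (𝓝 (h r)) :=
      (((hT.continuous_orbit (w (s + r))).comp (continuous_real_toNNReal.comp
        (continuous_const.sub continuous_id))).tendsto r).mono_left nhdsWithin_le_nhds
    have h3 := h1.add h2
    rw [zero_add] at h3
    refine h3.congr fun r' => ?_
    rw [map_sub, sub_add_cancel]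
  have hderiv : ∀ r ∈ Ico (0 : ℝ) τ, HasDerivWithinAt h 0 (Ici r) r := by
    intro r hr
    rw [← hasDerivWithinAt_Ioi_iff_Ici, hasDerivWithinAt_iff_tendsto_slope' self_notMem_Ioi]
    have h1 : Tendsto (fun r' => (r' - r)⁻¹ • (w (s + r') - w (s + r))) (𝓝[>] r)
        (𝓝 (y (s + r))) := by
      have := ((hw (s + r)).comp_const_add s r).hasDerivWithinAt (s := Ioi r)
      rw [hasDerivWithinAt_iff_tendsto_slope' self_notMem_Ioi] at this
      exact this
    have h2 : Tendsto (fun r' => (r' - r)⁻¹ • (T (r' - r).toNNReal (w (s + r)) - w (s + r)))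
        (𝓝[>] r) (𝓝 (y (s + r))) := by
      have hsub : Tendsto (fun r' : ℝ => (r' - r).toNNReal) (𝓝[>] r) (𝓝[>] 0) := by
        refine tendsto_nhdsWithin_iff.mpr ⟨?_, eventually_nhdsWithin_of_forall fun r' hr' =>
          Real.toNNReal_pos.mpr (sub_pos.mpr hr')⟩
        have : Continuous fun r' : ℝ => (r' - r).toNNReal := by fun_prop
        exact (this.tendsto' r 0 (by simp)).mono_left nhdsWithin_le_nhds
      refine (((hB _ _).mp (hg (s + r))).comp hsub).congr' ?_
      filter_upwards [self_mem_nhdsWithin] with r' hr'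
      rw [Function.comp_apply, Real.coe_toNNReal _ (sub_pos.mpr hr').le, ← Complex.ofReal_inv]
      exact algebraMap_smul ℂ (r' - r)⁻¹ _
    have h3 := h1.sub h2
    rw [sub_self] at h3
    -- The slope of `h` is `T(τ - r')` applied to the difference of two quotients with the same
    -- limit `y (s + r)`; uniform boundedness of `T` on `[0, τ]` preserves the limit zero.
    have h4 := tendsto_clm_apply_zero (C := C) (A := fun r' : ℝ => T (τ - r').toNNReal)
      (eventually_nhdsWithin_of_forall fun r' hr' => hC _ (hle r' (hr.1.trans (le_of_lt hr')))) h3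
    refine h4.congr' ?_
    filter_upwards [self_mem_nhdsWithin, nhdsWithin_le_nhds (Iio_mem_nhds hr.2)] with r' hr' hr''
    have hsplit : (τ - r).toNNReal = (τ - r').toNNReal + (r' - r).toNNReal := by
      rw [← Real.toNNReal_add (sub_pos.mpr hr'').le (sub_pos.mpr hr').le, sub_add_sub_cancel]
    have hcomm : ∀ (A : X →L[ℂ] X) (c : ℝ) (x : X), A (c • x) = c • A x := fun A c x => by
      rw [← algebraMap_smul ℂ c x, ← algebraMap_smul ℂ c (A x), map_smul]
    simp only [slope_def_module, h]
    rw [hsplit, hT.map_add, ContinuousLinearMap.comp_apply, ← smul_sub, hcomm, sub_sub_sub_cancel_right,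
      map_sub]
  have := constant_of_has_deriv_right_zero hcont hderiv τ ⟨τ.2, le_rfl⟩
  simpa [h, hT.map_zero] using this.symm

end Orbits

/-! ### The principal square root on the right half-plane -/

section SquareRoot

/-- The principal square root on the slit plane. -/
noncomputable def csqrt (z : ℂ) : ℂ := Complex.exp (Complex.log z / 2)

theorem csqrt_ne_zero (z : ℂ) : csqrt z ≠ 0 := Complex.exp_ne_zero _

theorem csqrt_mul_self {z : ℂ} (hz : z ≠ 0) : csqrt z * csqrt z = z := by
  rw [csqrt, ← Complex.exp_add, add_halves, Complex.exp_log hz]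

theorem norm_csqrt {z : ℂ} (hz : z ≠ 0) : ‖csqrt z‖ = √‖z‖ := by
  rw [eq_comm, Real.sqrt_eq_iff_mul_self_eq (norm_nonneg _) (norm_nonneg _), ← norm_mul,
    csqrt_mul_self hz]

theorem csqrt_re_pos {z : ℂ} (hz : 0 < z.re) : 0 < (csqrt z).re := by
  rw [csqrt, Complex.exp_re]
  have h := abs_lt.mp (Complex.abs_arg_lt_pi_div_two_iff.mpr (.inl hz))
  have him : (Complex.log z / 2).im = z.arg / 2 := by
    simp [Complex.log_im]
  rw [him]
  exact mul_pos (Real.exp_pos _) (Real.cos_pos_of_mem_Ioo ⟨by linarith, by linarith⟩)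

theorem abs_csqrt_im_lt {z : ℂ} (hz : 0 < z.re) : |(csqrt z).im| < (csqrt z).re := by
  have h0 : z ≠ 0 := by rintro rfl; simp at hz
  have h1 := congrArg Complex.re (csqrt_mul_self h0)
  rw [Complex.mul_re] at h1
  refine abs_lt_of_sq_lt_sq ?_ (csqrt_re_pos hz).le
  nlinarith

theorem hasDerivAt_csqrt {z : ℂ} (hz : 0 < z.re) :
    HasDerivAt csqrt (1 / (2 * csqrt z)) z := by
  have h0 : z ≠ 0 := by rintro rfl; simp at hz
  have h := ((Complex.hasDerivAt_log (Complex.mem_slitPlane_iff.mpr (.inl hz))).div_const 2).cexp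
  refine h.congr_deriv ?_
  change csqrt z * (z⁻¹ / 2) = _
  have h1 := csqrt_mul_self h0
  have h2 := csqrt_ne_zero z
  clear h h0 hz
  generalize csqrt z = s at h1 h2 ⊢
  subst h1
  field_simp

theorem re_csqrt_mul_csqrt_pos {z w : ℂ} (hz : 0 < z.re) (hw : 0 < w.re) :
    0 < (csqrt z * csqrt w).re := by
  rw [Complex.mul_re, sub_pos]
  refine (le_abs_self _).trans_lt ?_
  rw [abs_mul]
  exact mul_lt_mul'' (abs_csqrt_im_lt hz) (abs_csqrt_im_lt hw) (abs_nonneg _) (abs_nonneg _)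

theorem two_mul_re_sq (z : ℂ) : 2 * z.re ^ 2 = ‖z * z‖ + (z * z).re := by
  rw [norm_mul, ← sq, Complex.sq_norm, Complex.normSq_apply, Complex.mul_re]
  ring

/-- Each root has argument below `π/4` in modulus, so the product has positive real part; this fixes
the sign in `2 (Re ζ)² = |ζ²| + Re ζ²`. -/
theorem two_mul_re_csqrt_mul_csqrt {z w : ℂ} (hz : 0 < z.re) (hw : 0 < w.re) :
    2 * (csqrt z * csqrt w).re = √(2 * (‖z * w‖ + (z * w).re)) := by
  have h0 : z ≠ 0 := by rintro rfl; simp at hz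
  have h0' : w ≠ 0 := by rintro rfl; simp at hw
  have h1 : csqrt z * csqrt w * (csqrt z * csqrt w) = z * w := by
    rw [mul_mul_mul_comm, csqrt_mul_self h0, csqrt_mul_self h0']
  rw [eq_comm, ← h1, ← two_mul_re_sq]
  refine (congrArg Real.sqrt (by ring)).trans
    (Real.sqrt_sq (mul_nonneg zero_le_two (re_csqrt_mul_csqrt_pos hz hw).le))

end SquareRoot

/-! ### Explicit solutions of `u' = A⁻¹u` -/

section ExplicitSolution

/-- The function `α^(-1/2) exp(-2 (αβ)^(1/2))`, `α = a - ix`, `β = b - it`. -/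
noncomputable def waveU (a b t x : ℝ) : ℂ :=
  Complex.exp (-2 * (csqrt (a - x * Complex.I) * csqrt (b - t * Complex.I))) /
    csqrt (a - x * Complex.I)

/-- The function `β^(-1/2) exp(-2 (αβ)^(1/2))`, `α = a - ix`, `β = b - it`. -/
noncomputable def waveV (a b t x : ℝ) : ℂ :=
  Complex.exp (-2 * (csqrt (a - x * Complex.I) * csqrt (b - t * Complex.I))) /
    csqrt (b - t * Complex.I)

variable {a b : ℝ}

theorem re_sub_mul_I (a x : ℝ) : ((a : ℂ) - x * Complex.I).re = a := by simp

theorem hasDerivAt_csqrt_sub_mul_I (ha : 0 < a) (x : ℝ) :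
    HasDerivAt (fun y : ℝ => csqrt (a - y * Complex.I))
      (-Complex.I / (2 * csqrt (a - x * Complex.I))) x := by
  have h1 : HasDerivAt (fun y : ℝ => (a : ℂ) - y * Complex.I) (-Complex.I) x := by
    simpa using ((hasDerivAt_id x).ofReal_comp.mul_const Complex.I).const_sub (a : ℂ)
  have h2 : HasDerivAt csqrt (1 / (2 * csqrt (a - x * Complex.I))) (a - x * Complex.I) :=
    hasDerivAt_csqrt (by rw [re_sub_mul_I]; exact ha)
  refine (h2.comp x h1).congr_deriv ?_
  ring

/-- The `α`-derivative of `exp(-2√(αβ))` brings down `-√(β/α)`, which trades `β^(-1/2)` for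
`-α^(-1/2)`; then `dα/dx = -i`. The time derivative of `waveU` is the same computation with the
roles exchanged. -/
theorem hasDerivAt_waveV (ha : 0 < a) (t x : ℝ) :
    HasDerivAt (waveV a b t) (Complex.I * waveU a b t x) x := by
  have h := ((((hasDerivAt_csqrt_sub_mul_I ha x).mul_const
    (csqrt (b - t * Complex.I))).const_mul (-2)).cexp).div_const (csqrt (b - t * Complex.I))
  refine h.congr_deriv ?_
  have h1 := csqrt_ne_zero (a - x * Complex.I)
  have h2 := csqrt_ne_zero (b - t * Complex.I)
  rw [waveU]
  generalize csqrt (a - x * Complex.I) = A at h1 ⊢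
  generalize csqrt (b - t * Complex.I) = B at h2 ⊢
  field_simp

theorem hasDerivAt_waveU (hb : 0 < b) (t x : ℝ) :
    HasDerivAt (fun s => waveU a b s x) (Complex.I * waveV a b t x) t := by
  have h := ((((hasDerivAt_csqrt_sub_mul_I hb t).const_mul
    (csqrt (a - x * Complex.I))).const_mul (-2)).cexp).div_const (csqrt (a - x * Complex.I))
  refine h.congr_deriv ?_
  have h1 := csqrt_ne_zero (a - x * Complex.I)
  have h2 := csqrt_ne_zero (b - t * Complex.I)
  rw [waveV]
  generalize csqrt (a - x * Complex.I) = A at h1 ⊢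
  generalize csqrt (b - t * Complex.I) = B at h2 ⊢
  field_simp

theorem continuous_waveV (ha : 0 < a) (b t : ℝ) : Continuous (waveV a b t) :=
  continuous_iff_continuousAt.mpr fun x => (hasDerivAt_waveV ha t x).continuousAt

theorem continuous_waveU (ha : 0 < a) (b t : ℝ) : Continuous (waveU a b t) := by
  have h : Continuous fun x : ℝ => csqrt (a - x * Complex.I) :=
    continuous_iff_continuousAt.mpr fun x => (hasDerivAt_csqrt_sub_mul_I ha x).continuousAt
  exact ((continuous_const.mul (h.mul continuous_const)).cexp).div h fun x => csqrt_ne_zero _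

theorem norm_cexp_csqrt (ha : 0 < a) (hb : 0 < b) (t x : ℝ) :
    ‖Complex.exp (-2 * (csqrt (a - x * Complex.I) * csqrt (b - t * Complex.I)))‖ =
      Real.exp (-√(2 * (√((a ^ 2 + x ^ 2) * (b ^ 2 + t ^ 2)) + (a * b - x * t)))) := by
  have h1 : ∀ c y : ℝ, ‖(c : ℂ) - y * Complex.I‖ = √(c ^ 2 + y ^ 2) := fun c y => by
    have := Complex.norm_add_mul_I c (-y)
    rwa [Complex.ofReal_neg, neg_mul, ← sub_eq_add_neg, neg_sq] at this
  have h2 : (((a : ℂ) - x * Complex.I) * (b - t * Complex.I)).re = a * b - x * t := by simp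
  have h3 := two_mul_re_csqrt_mul_csqrt (z := a - x * Complex.I) (w := b - t * Complex.I)
    (by rw [re_sub_mul_I]; exact ha) (by rw [re_sub_mul_I]; exact hb)
  rw [h2, norm_mul, h1, h1, ← Real.sqrt_mul (by positivity)] at h3
  rw [Complex.norm_exp, ← h3]
  congr 1
  have : (-2 : ℂ) = ((-2 : ℝ) : ℂ) := by norm_num
  rw [this, Complex.re_ofReal_mul, neg_mul]

theorem norm_csqrt_sub_mul_I (ha : 0 < a) (x : ℝ) :
    ‖csqrt (a - x * Complex.I)‖ = √√(a ^ 2 + x ^ 2) := by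
  have h0 : (a : ℂ) - x * Complex.I ≠ 0 := by
    intro h
    have := re_sub_mul_I a x
    rw [h, Complex.zero_re] at this
    exact ha.ne this
  have := Complex.norm_add_mul_I a (-x)
  rw [Complex.ofReal_neg, neg_mul, ← sub_eq_add_neg, neg_sq] at this
  rw [norm_csqrt h0, this]

theorem norm_waveU (ha : 0 < a) (hb : 0 < b) (t x : ℝ) :
    ‖waveU a b t x‖ =
      Real.exp (-√(2 * (√((a ^ 2 + x ^ 2) * (b ^ 2 + t ^ 2)) + (a * b - x * t)))) /
        √√(a ^ 2 + x ^ 2) := by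
  rw [waveU, norm_div, norm_cexp_csqrt ha hb, norm_csqrt_sub_mul_I ha]

theorem norm_waveV (ha : 0 < a) (hb : 0 < b) (t x : ℝ) :
    ‖waveV a b t x‖ =
      Real.exp (-√(2 * (√((a ^ 2 + x ^ 2) * (b ^ 2 + t ^ 2)) + (a * b - x * t)))) /
        √√(b ^ 2 + t ^ 2) := by
  rw [waveV, norm_div, norm_cexp_csqrt ha hb, norm_csqrt_sub_mul_I hb]

theorem exp_neg_mul_pow_le {s : ℝ} (hs : 0 ≤ s) (n : ℕ) :
    Real.exp (-s) * s ^ n ≤ n.factorial := by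
  have h := Real.pow_div_factorial_le_exp s hs n
  rw [div_le_iff₀ (by positivity)] at h
  calc Real.exp (-s) * s ^ n ≤ Real.exp (-s) * (Real.exp s * n.factorial) := by gcongr
    _ = n.factorial := by rw [← mul_assoc, ← Real.exp_add]; simp

theorem exp_phase_le (ha : 0 < a) (hb : 0 < b) {R t : ℝ} (ht : |t| ≤ R) (x : ℝ) :
    Real.exp (-√(2 * (√((a ^ 2 + x ^ 2) * (b ^ 2 + t ^ 2)) + (a * b - x * t)))) ≤
      6 * ((b + 2 * R) / b ^ 2) ^ 2 / (a ^ 2 + x ^ 2) := by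
  have hR : 0 ≤ R := (abs_nonneg t).trans ht
  set A := √(a ^ 2 + x ^ 2) with hA
  set B := √(b ^ 2 + t ^ 2) with hB
  have hA2 : A ^ 2 = a ^ 2 + x ^ 2 := Real.sq_sqrt (by positivity)
  have hB2 : B ^ 2 = b ^ 2 + t ^ 2 := Real.sq_sqrt (by positivity)
  have hA0 : 0 < A := Real.sqrt_pos.mpr (by positivity)
  have hB0 : 0 < B := Real.sqrt_pos.mpr (by positivity)
  have hxA : |x| ≤ A := by rw [hA, ← Real.sqrt_sq_eq_abs]; exact Real.sqrt_le_sqrt (by nlinarith)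
  have hBle : B ≤ b + |t| := by
    refine Real.sqrt_le_iff.mpr ⟨by positivity, ?_⟩
    nlinarith [sq_abs t, mul_nonneg hb.le (abs_nonneg t)]
  -- From `B - |t| = b² / (B + |t|)` and `B ≤ b + |t|`, this is a lower bound for `B - |t|` uniform
  -- in `|t| ≤ R`, so the phase grows at least like `κ A`.
  set κ := b ^ 2 / (b + 2 * R) with hκ
  have hκ0 : 0 < κ := by positivity
  have hκB : κ ≤ B - |t| := by
    rw [hκ, div_le_iff₀ (by positivity)]
    have h1 : b ^ 2 = (B - |t|) * (B + |t|) := by nlinarith [sq_abs t]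
    have h2 : 0 ≤ B - |t| := by
      by_contra h
      have h3 : 0 < B + |t| := by positivity
      nlinarith [mul_pos (neg_pos.mpr (not_le.mp h)) h3]
    rw [h1]
    exact mul_le_mul_of_nonneg_left (by linarith) h2
  have hxt : x * t ≤ A * |t| :=
    (le_abs_self _).trans (by rw [abs_mul]; exact mul_le_mul_of_nonneg_right hxA (abs_nonneg t))
  have hAB : √((a ^ 2 + x ^ 2) * (b ^ 2 + t ^ 2)) = A * B := Real.sqrt_mul (by positivity) _
  rw [hAB]
  have hlow : κ * A ≤ A * B + (a * b - x * t) := by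
    nlinarith [mul_le_mul_of_nonneg_right hκB hA0.le, mul_pos ha hb]
  have h1 : Real.exp (-√(2 * (A * B + (a * b - x * t)))) ≤ Real.exp (-√(2 * (κ * A))) :=
    Real.exp_le_exp.mpr (neg_le_neg (Real.sqrt_le_sqrt (by linarith)))
  refine h1.trans ?_
  -- The fourth power of the root yields decay of order `A⁻²`; the constant `6` is `4! / 4`.
  have h2 := exp_neg_mul_pow_le (Real.sqrt_nonneg (2 * (κ * A))) 4
  have h3 : √(2 * (κ * A)) ^ 4 = 4 * κ ^ 2 * (a ^ 2 + x ^ 2) := by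
    rw [show √(2 * (κ * A)) ^ 4 = (√(2 * (κ * A)) ^ 2) ^ 2 by ring,
      Real.sq_sqrt (by positivity), ← hA2]
    ring
  rw [h3] at h2
  have h4 : (b + 2 * R) / b ^ 2 = κ⁻¹ := by rw [hκ, inv_div]
  rw [h4, le_div_iff₀ (by positivity), inv_pow, ← div_eq_mul_inv, le_div_iff₀ (by positivity)]
  have h5 : ((4 : ℕ).factorial : ℝ) = 24 := by norm_num [Nat.factorial]
  rw [h5] at h2
  linarith

theorem exists_norm_wave_le (ha : 0 < a) (hb : 0 < b) (R : ℝ) : ∃ C, 0 ≤ C ∧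
    ∀ t, |t| ≤ R → ∀ x, ‖waveU a b t x‖ ≤ C * (1 + x ^ 2)⁻¹ ∧
      ‖waveV a b t x‖ ≤ C * (1 + x ^ 2)⁻¹ := by
  set K := 6 * ((b + 2 * R) / b ^ 2) ^ 2
  have hx : ∀ x : ℝ, (a ^ 2 + x ^ 2)⁻¹ ≤ (1 + (a ^ 2)⁻¹) * (1 + x ^ 2)⁻¹ := fun x => by
    rw [← div_eq_mul_inv, le_div_iff₀ (by positivity), inv_mul_le_iff₀ (by positivity)]
    have : a ^ 2 * (a ^ 2)⁻¹ = 1 := mul_inv_cancel₀ (by positivity)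
    have h2 : 0 ≤ x ^ 2 * (a ^ 2)⁻¹ := by positivity
    nlinarith [sq_nonneg a]
  refine ⟨K * (1 + (a ^ 2)⁻¹) * ((√a)⁻¹ + (√b)⁻¹), by positivity, fun t ht x => ?_⟩
  have hE := exp_phase_le ha hb ht x
  have h1 : ∀ c y : ℝ, 0 < c → (√√(c ^ 2 + y ^ 2))⁻¹ ≤ (√c)⁻¹ := fun c y hc => by
    refine inv_anti₀ (Real.sqrt_pos.mpr hc) (Real.sqrt_le_sqrt (Real.le_sqrt_of_sq_le ?_))
    nlinarith [sq_nonneg y]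
  have h2 : ∀ d : ℝ, 0 ≤ d → d ≤ (√a)⁻¹ + (√b)⁻¹ →
      Real.exp (-√(2 * (√((a ^ 2 + x ^ 2) * (b ^ 2 + t ^ 2)) + (a * b - x * t)))) * d ≤
        K * (1 + (a ^ 2)⁻¹) * ((√a)⁻¹ + (√b)⁻¹) * (1 + x ^ 2)⁻¹ := fun d hd0 hd => by
    calc _ ≤ K / (a ^ 2 + x ^ 2) * d := by gcongr
      _ ≤ K * ((1 + (a ^ 2)⁻¹) * (1 + x ^ 2)⁻¹) * ((√a)⁻¹ + (√b)⁻¹) := by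
        rw [div_eq_mul_inv]
        gcongr
        exact hx x
      _ = _ := by ring
  rw [norm_waveU ha hb, norm_waveV ha hb, div_eq_mul_inv, div_eq_mul_inv]
  exact ⟨h2 _ (by positivity) ((h1 a x ha).trans (le_add_of_nonneg_right (by positivity))),
    h2 _ (by positivity) ((h1 b t hb).trans (le_add_of_nonneg_left (by positivity)))⟩

/-- The mean value inequality bounds the time quotients by a fixed `L^p` function, as needed to
upgrade the pointwise derivative to a norm derivative. -/
theorem norm_slope_waveU_sub_le (ha : 0 < a) (hb : 0 < b) (t : ℝ) : ∃ C, ∀ s ∈ Metric.ball t 1,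
    ∀ x, ‖(s - t)⁻¹ • (waveU a b s x - waveU a b t x) - Complex.I * waveV a b t x‖ ≤
      C * (1 + x ^ 2)⁻¹ := by
  obtain ⟨C, hC0, hC⟩ := exists_norm_wave_le ha hb (|t| + 1)
  refine ⟨C + C, fun s hs x => ?_⟩
  have hV : ∀ r ∈ Metric.ball t 1, ‖Complex.I * waveV a b r x‖ ≤ C * (1 + x ^ 2)⁻¹ := by
    intro r hr
    rw [Metric.mem_ball, Real.dist_eq] at hr
    have := abs_sub_abs_le_abs_sub r t
    rw [norm_mul, Complex.norm_I, one_mul]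
    exact (hC r (by linarith) x).2
  have hd : ‖waveU a b s x - waveU a b t x‖ ≤ C * (1 + x ^ 2)⁻¹ * ‖s - t‖ :=
    (convex_ball t 1).norm_image_sub_le_of_norm_hasDerivWithin_le
      (f := fun r => waveU a b r x) (f' := fun r => Complex.I * waveV a b r x)
      (fun r _ => (hasDerivAt_waveU hb r x).hasDerivWithinAt) hV
      (Metric.mem_ball_self one_pos) hs
  rw [add_mul]
  refine (norm_sub_le _ _).trans (add_le_add ?_ (hV t (Metric.mem_ball_self one_pos)))
  rw [norm_smul, norm_inv]
  rcases eq_or_ne s t with rfl | hst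
  · rw [sub_self, norm_zero, inv_zero, zero_mul]
    positivity
  · rw [inv_mul_le_iff₀ (norm_pos_iff.mpr (sub_ne_zero.mpr hst)), mul_comm]
    exact hd

theorem memLp_inv_one_add_sq {p : ℝ≥0∞} (hp1 : 1 ≤ p) (hp : p ≠ ⊤) :
    MemLp (fun x : ℝ => (1 + x ^ 2)⁻¹) p := by
  have hcont : Continuous fun x : ℝ => (1 + x ^ 2)⁻¹ :=
    Continuous.inv₀ (by fun_prop) fun x => by positivity
  have hp1' : 1 ≤ p.toReal := by
    simpa using (ENNReal.toReal_le_toReal ENNReal.one_ne_top hp).mpr hp1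
  rw [← integrable_norm_rpow_iff hcont.aestronglyMeasurable
    (zero_lt_one.trans_le hp1).ne' hp]
  refine integrable_inv_one_add_sq.mono'
    (hcont.norm.rpow_const fun _ => .inr (by linarith)).aestronglyMeasurable
    (.of_forall fun x => ?_)
  have h0 : 0 ≤ (1 + x ^ 2)⁻¹ := by positivity
  have h1 : (1 + x ^ 2)⁻¹ ≤ 1 := inv_le_one_of_one_le₀ (by nlinarith)
  rw [Real.norm_of_nonneg (by positivity), Real.norm_of_nonneg h0]
  exact (Real.rpow_le_rpow_of_exponent_ge (by positivity) h1 hp1').trans_eq (Real.rpow_one _)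

variable {p : ℝ≥0∞}

theorem memLp_waveU (hp1 : 1 ≤ p) (hp : p ≠ ⊤) (ha : 0 < a) (hb : 0 < b) (t : ℝ) :
    MemLp (waveU a b t) p := by
  obtain ⟨C, -, hC⟩ := exists_norm_wave_le ha hb |t|
  exact ((memLp_inv_one_add_sq hp1 hp).const_mul C).mono'
    (continuous_waveU ha b t).aestronglyMeasurable (.of_forall fun x => (hC t le_rfl x).1)

theorem memLp_waveV (hp1 : 1 ≤ p) (hp : p ≠ ⊤) (ha : 0 < a) (hb : 0 < b) (t : ℝ) :
    MemLp (waveV a b t) p := by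
  obtain ⟨C, -, hC⟩ := exists_norm_wave_le ha hb |t|
  exact ((memLp_inv_one_add_sq hp1 hp).const_mul C).mono'
    (continuous_waveV ha b t).aestronglyMeasurable (.of_forall fun x => (hC t le_rfl x).2)

variable [Fact (1 ≤ p)]

/-- A classical derivative in `L^p` is a weak derivative. -/
theorem isWeakDeriv_toLp {u u' : ℝ → ℂ} (hu : MemLp u p) (hu' : MemLp u' p)
    (h : ∀ x, HasDerivAt u (u' x) x) : IsWeakDeriv (hu.toLp u) (hu'.toLp u') := by
  intro φ hφ hc
  have e₁ : ∫ x, deriv φ x • hu.toLp u x = ∫ x, deriv φ x • u x :=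
    integral_congr_ae (hu.coeFn_toLp.mono fun x hx => by simp only [hx])
  have e₂ : ∫ x, φ x • hu'.toLp u' x = ∫ x, φ x • u' x :=
    integral_congr_ae (hu'.coeFn_toLp.mono fun x hx => by simp only [hx])
  have i₁ : Integrable fun x => deriv φ x • u x :=
    (integrable_deriv_smul_Lp (hu.toLp u) hφ hc).congr
      (hu.coeFn_toLp.mono fun x hx => by simp only [hx])
  have i₂ : Integrable fun x => φ x • u' x :=
    (integrable_smul_Lp (hu'.toLp u') hφ.continuous hc).congr
      (hu'.coeFn_toLp.mono fun x hx => by simp only [hx])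
  have i₃ : Integrable fun x => φ x • u x :=
    (integrable_smul_Lp (hu.toLp u) hφ.continuous hc).congr
      (hu.coeFn_toLp.mono fun x hx => by simp only [hx])
  have h0 := integral_eq_zero_of_hasDerivAt_of_integrable
    (fun x => ((hφ.differentiable (by simp) x).hasDerivAt).smul (h x)) (i₂.add i₁) i₃
  rw [integral_add i₂ i₁] at h0
  rw [e₁, e₂]
  exact eq_neg_of_add_eq_zero_right h0

/-- Indeed `A(iv) = -i ∂ₓv = u`, so `A⁻¹u = iv`, which is also the time derivative of `u`. -/
theorem waveU_mem_graph_inverse (hp1 : 1 < p) (hp : p ≠ ⊤) (ha : 0 < a) (hb : 0 < b) (t : ℝ) :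
    ((memLp_waveU hp1.le hp ha hb t).toLp (waveU a b t),
      Complex.I • (memLp_waveV hp1.le hp ha hb t).toLp (waveV a b t)) ∈
        (shiftGenerator p).inverse.graph := by
  rw [mem_graph_inverse_iff hp1 hp, mem_graph_shiftGenerator_iff]
  have h := (isWeakDeriv_toLp (memLp_waveV hp1.le hp ha hb t)
    ((memLp_waveU hp1.le hp ha hb t).const_smul Complex.I)
    (hasDerivAt_waveV ha t)).smul Complex.I
  rwa [MemLp.toLp_const_smul, smul_smul, Complex.I_mul_I, neg_one_smul] at h

theorem hasDerivAt_waveU_toLp (hp1 : 1 ≤ p) (hp : p ≠ ⊤) (ha : 0 < a) (hb : 0 < b) (t : ℝ) :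
    HasDerivAt (fun s => (memLp_waveU hp1 hp ha hb s).toLp (waveU a b s))
      (Complex.I • (memLp_waveV hp1 hp ha hb t).toLp (waveV a b t)) t := by
  rw [hasDerivAt_iff_tendsto_slope]
  obtain ⟨C, hC⟩ := norm_slope_waveU_sub_le ha hb t
  refine tendsto_Lp_of_dominated hp ((memLp_inv_one_add_sq hp1 hp).const_mul C)
    (u := fun s x => (s - t)⁻¹ • (waveU a b s x - waveU a b t x))
    (v := fun x => Complex.I * waveV a b t x) (fun s => ?_) ?_ ?_ ?_
  · rw [slope_def_module, ← MemLp.toLp_sub, ← MemLp.toLp_const_smul]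
    exact MemLp.coeFn_toLp _
  · rw [← MemLp.toLp_const_smul]
    exact MemLp.coeFn_toLp _
  · filter_upwards [nhdsWithin_le_nhds (Metric.ball_mem_nhds t one_pos)] with s hs
    exact .of_forall fun x => (hC s hs x).trans (Real.le_norm_self _)
  · refine .of_forall fun x => (hasDerivAt_iff_tendsto_slope.mp (hasDerivAt_waveU hb t x)).congr
      fun s => ?_
    rw [slope_def_module]

/-- The semigroup generated by the inverse of the shift generator acts on the explicit family. -/
theorem apply_waveU_of_generates (hp1 : 1 < p) (hp : p ≠ ⊤) {T : ℝ≥0 → LpReal p →L[ℂ] LpReal p}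
    (hT : IsC0Semigroup T) (hA : IsSemigroupGenerator (shiftGenerator p).inverse T)
    (ha : 0 < a) (hb : 0 < b) (s : ℝ) (τ : ℝ≥0) :
    T τ ((memLp_waveU hp1.le hp ha hb s).toLp (waveU a b s)) =
      (memLp_waveU hp1.le hp ha hb (s + τ)).toLp (waveU a b (s + τ)) :=
  hT.apply_eq_of_hasDerivAt hA (hasDerivAt_waveU_toLp hp1.le hp ha hb)
    (waveU_mem_graph_inverse hp1 hp ha hb) s τ

end ExplicitSolution

/-! ### Norm growth as `τ → ∞`: the case `p ≠ 2` -/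

section Asymptotics

theorem eLpNorm_comp_div {p : ℝ≥0∞} {E : Type*} [NormedAddCommGroup E] {f : ℝ → E}
    (hf : Continuous f) {c : ℝ} (hc : 0 < c) :
    eLpNorm (fun x => f (x / c)) p volume =
      ENNReal.ofReal c ^ (1 / p.toReal) * eLpNorm f p volume := by
  have h := eLpNorm_map_measure (p := p) (μ := (volume : Measure ℝ)) (f := fun x : ℝ => x * c⁻¹)
    (g := f) hf.aestronglyMeasurable (by fun_prop)
  rw [Real.map_volume_mul_right (inv_ne_zero hc.ne'), inv_inv, abs_of_pos hc,
    eLpNorm_smul_measure_of_ne_zero (by simpa using hc)] at h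
  simpa [Function.comp_def, div_eq_mul_inv] using h.symm

theorem toReal_eLpNorm_const_mul_comp_div {p : ℝ≥0∞} {f : ℝ → ℝ}
    (hf : Continuous f) {c k : ℝ} (hc : 0 < c) (hk : 0 ≤ k) :
    (eLpNorm (fun x => k * f (x / c)) p volume).toReal =
      k * (c ^ (1 / p.toReal) * (eLpNorm f p volume).toReal) := by
  have h := eLpNorm_const_smul k (fun x => f (x / c)) p volume
  simp only [Pi.smul_def, smul_eq_mul] at h
  rw [h, eLpNorm_comp_div hf hc, ENNReal.toReal_mul, ENNReal.toReal_mul,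
    ← ENNReal.toReal_rpow, ENNReal.toReal_ofReal hc.le, toReal_enorm, Real.norm_of_nonneg hk]

/-- With `b = 1/a` the product `αβ` at `t = 0` depends on `x/τ` only. -/
theorem norm_waveU_zero {τ : ℝ} (hτ : 0 < τ) (x : ℝ) :
    ‖waveU τ τ⁻¹ 0 x‖ = (√τ)⁻¹ * ‖waveU 1 1 0 (x / τ)‖ := by
  rw [norm_waveU hτ (inv_pos.mpr hτ), norm_waveU one_pos one_pos]
  have h1 : (τ ^ 2 + x ^ 2) * (τ⁻¹ ^ 2 + 0 ^ 2) = (1 ^ 2 + (x / τ) ^ 2) * (1 ^ 2 + 0 ^ 2) := by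
    field_simp
    ring
  have h2 : τ * τ⁻¹ - x * 0 = 1 * 1 - x / τ * 0 := by
    rw [mul_inv_cancel₀ hτ.ne']; ring
  have h3 : √√(τ ^ 2 + x ^ 2) = √τ * √√(1 ^ 2 + (x / τ) ^ 2) := by
    rw [← Real.sqrt_mul hτ.le]
    congr 1
    rw [show τ ^ 2 + x ^ 2 = τ ^ 2 * (1 ^ 2 + (x / τ) ^ 2) by field_simp,
      Real.sqrt_mul (sq_nonneg τ), Real.sqrt_sq hτ.le]
  rw [h1, h2, h3, div_mul_eq_div_div, div_eq_inv_mul _ √τ, mul_div_assoc]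

/-- Here `αβ = 1 + x + i(τ - x/τ)` and the right side is `|αβ| + Re αβ`. For `x ≥ 0` the modulus
alone suffices; for `x ≤ 0` cancellation is avoided through `(|αβ| + Re αβ)(|αβ| - Re αβ) = (Im
αβ)²`. The relevant length scale is `τ²`. -/
theorem phase_lower_bound {τ : ℝ} (hτ : 1 ≤ τ) (x : ℝ) :
    ((τ + |x|) / τ ^ 2 + ((τ + |x|) / τ ^ 2)⁻¹) / 16 ≤
      √((τ ^ 2 + x ^ 2) * (τ⁻¹ ^ 2 + (-1) ^ 2)) + (τ * τ⁻¹ - x * (-1)) := by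
  have hτ0 : 0 < τ := one_pos.trans_le hτ
  set r := τ + |x| with hr
  have hrτ : τ ≤ r := le_add_of_nonneg_right (abs_nonneg x)
  have hr0 : 0 < r := hτ0.trans_le hrτ
  set L := √((τ ^ 2 + x ^ 2) * (τ⁻¹ ^ 2 + (-1) ^ 2)) with hL
  have hL0 : 0 ≤ L := Real.sqrt_nonneg _
  have hL2 : L ^ 2 = (τ ^ 2 + x ^ 2) * (τ⁻¹ ^ 2 + (-1) ^ 2) := Real.sq_sqrt (by positivity)
  have hinv1 : τ⁻¹ ≤ 1 := inv_le_one_of_one_le₀ hτ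
  have hinv0 : 0 < τ⁻¹ := inv_pos.mpr hτ0
  have hinv : τ * τ⁻¹ = 1 := mul_inv_cancel₀ hτ0.ne'
  have hfac : L ^ 2 = (1 + x) ^ 2 + (τ - x * τ⁻¹) ^ 2 := by
    rw [hL2]
    linear_combination (τ * τ⁻¹ + 1 + 2 * x) * hinv
  have hS : (r / τ ^ 2 + (r / τ ^ 2)⁻¹) / 16 = (τ ^ 2 + (r * τ⁻¹) ^ 2) / (16 * r) := by
    field_simp
    ring
  have hx2 := sq_abs x
  rw [hS, div_le_iff₀ (by positivity), hinv]
  rcases le_total x 0 with hx | hx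
  · rw [abs_of_nonpos hx] at hr
    have hL2r : L ≤ 2 * r := by
      refine abs_le_of_sq_le_sq' ?_ (by positivity) |>.2
      rw [hL2]
      have : τ⁻¹ ^ 2 + (-1) ^ 2 ≤ 2 := by nlinarith
      nlinarith [mul_le_mul_of_nonneg_left this (by positivity : 0 ≤ τ ^ 2 + x ^ 2),
        mul_nonneg hτ0.le (neg_nonneg.mpr hx)]
    have hRe : |1 + x| ≤ L := abs_le_of_sq_le_sq (by nlinarith [sq_nonneg (τ - x * τ⁻¹)]) hL0
    have hRe' := abs_le.mp hRe
    have him : (L + (1 + x)) * (L - (1 + x)) = (τ - x * τ⁻¹) ^ 2 := by linear_combination hfac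
    have h1 : (τ - x * τ⁻¹) ^ 2 ≤ (L + (1 + x)) * (4 * r) := by
      rw [← him]
      exact mul_le_mul_of_nonneg_left (by linarith) (by linarith)
    have h2 : r * τ⁻¹ = 1 - x * τ⁻¹ := by rw [hr]; linear_combination hinv
    have h3 : 0 ≤ -x * τ⁻¹ := mul_nonneg (neg_nonneg.mpr hx) hinv0.le
    have h4 : (τ + r * τ⁻¹) / 2 ≤ τ - x * τ⁻¹ := by rw [h2]; linarith
    have h5 : 0 ≤ τ * (r * τ⁻¹) := by positivity
    have h6 : 0 ≤ (τ + r * τ⁻¹) / 2 := by positivity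
    nlinarith [mul_le_mul h4 h4 h6 (h6.trans h4)]
  · rw [abs_of_nonneg hx] at hr
    have hLr : r / 2 ≤ L := by
      refine abs_le_of_sq_le_sq' ?_ hL0 |>.2
      rw [hL2]
      have : (1 : ℝ) ≤ τ⁻¹ ^ 2 + (-1) ^ 2 := by nlinarith [sq_nonneg τ⁻¹]
      nlinarith [mul_le_mul_of_nonneg_left this (by positivity : 0 ≤ τ ^ 2 + x ^ 2),
        sq_nonneg (τ - x)]
    have h1 : r * τ⁻¹ ≤ r := mul_le_of_le_one_right hr0.le hinv1
    have h2 : (r * τ⁻¹) ^ 2 ≤ r ^ 2 := by gcongr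
    have h3 : τ ^ 2 ≤ r ^ 2 := by gcongr
    nlinarith

theorem norm_waveU_neg_one_le {τ : ℝ} (hτ : 1 ≤ τ) (x : ℝ) :
    ‖waveU τ τ⁻¹ (-1) x‖ ≤ 30720 * τ⁻¹ * (1 + (x / τ ^ 2) ^ 2)⁻¹ := by
  have hτ0 : 0 < τ := one_pos.trans_le hτ
  rw [norm_waveU hτ0 (inv_pos.mpr hτ0)]
  have hP := phase_lower_bound hτ x
  set P := √((τ ^ 2 + x ^ 2) * (τ⁻¹ ^ 2 + (-1) ^ 2)) + (τ * τ⁻¹ - x * (-1))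
  set R := (τ + |x|) / τ ^ 2 with hR
  have hR0 : 0 < R := by positivity
  -- Both the prefactor, at most `4s/τ`, and the weight, at most `64 s⁴`, are absorbed by `exp(-s)`;
  -- hence `30720 = 4 · 64 · 5!`.
  set s := √((R + R⁻¹) / 8) with hs
  have hs0 : 0 ≤ s := Real.sqrt_nonneg _
  have hs2 : s ^ 2 = (R + R⁻¹) / 8 := Real.sq_sqrt (by positivity)
  have hRR : R * R⁻¹ = 1 := mul_inv_cancel₀ hR0.ne'
  have hRi : 0 < R⁻¹ := inv_pos.mpr hR0
  have h1 : Real.exp (-√(2 * P)) ≤ Real.exp (-s) :=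
    Real.exp_le_exp.mpr (neg_le_neg (Real.sqrt_le_sqrt (by linarith)))
  have h2 : τ * √(R / 2) ≤ √√(τ ^ 2 + x ^ 2) := by
    refine Real.le_sqrt_of_sq_le (Real.le_sqrt_of_sq_le ?_)
    rw [mul_pow, Real.sq_sqrt (by positivity), hR]
    have : τ ^ 2 * ((τ + |x|) / τ ^ 2 / 2) = (τ + |x|) / 2 := by field_simp
    rw [this]
    nlinarith [sq_abs x, sq_nonneg (τ - |x|), sq_nonneg (τ + |x|)]
  have h3 : (√(R / 2))⁻¹ ≤ 4 * s := by
    rw [← Real.sqrt_inv]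
    refine Real.sqrt_le_iff.mpr ⟨by positivity, ?_⟩
    rw [mul_pow, hs2, inv_div, div_eq_mul_inv]
    linarith
  have h4 : 1 + R ^ 2 ≤ 64 * s ^ 4 := by
    have : s ^ 4 = ((R + R⁻¹) / 8) ^ 2 := by rw [← hs2]; ring
    rw [this]
    nlinarith [sq_nonneg R⁻¹]
  have h5 : (x / τ ^ 2) ^ 2 ≤ R ^ 2 := by
    rw [div_pow, hR, div_pow]
    refine div_le_div_of_nonneg_right ?_ (by positivity)
    nlinarith [sq_abs x, mul_nonneg hτ0.le (abs_nonneg x), sq_nonneg τ]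
  have h6 := exp_neg_mul_pow_le hs0 5
  have h7 : ((5 : ℕ).factorial : ℝ) = 120 := by norm_num [Nat.factorial]
  rw [h7] at h6
  rw [← div_eq_mul_inv, le_div_iff₀ (by positivity)]
  calc Real.exp (-√(2 * P)) / √√(τ ^ 2 + x ^ 2) * (1 + (x / τ ^ 2) ^ 2)
      ≤ Real.exp (-s) / (τ * √(R / 2)) * (64 * s ^ 4) := by
        gcongr
        linarith
    _ = Real.exp (-s) * τ⁻¹ * (√(R / 2))⁻¹ * (64 * s ^ 4) := by
        rw [div_eq_mul_inv, mul_inv]; ring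
    _ ≤ Real.exp (-s) * τ⁻¹ * (4 * s) * (64 * s ^ 4) := by gcongr
    _ = 256 * τ⁻¹ * (Real.exp (-s) * s ^ 5) := by ring
    _ ≤ 256 * τ⁻¹ * 120 := by gcongr
    _ = 30720 * τ⁻¹ := by ring

theorem le_norm_waveU_one {τ x : ℝ} (hτ : 2 ≤ τ) (hx : x ∈ Icc (τ ^ 2) (2 * τ ^ 2)) :
    Real.exp (-5) / (2 * τ) ≤ ‖waveU τ τ⁻¹ 1 x‖ := by
  have hτ0 : 0 < τ := two_pos.trans_le hτ
  obtain ⟨hx1, hx2⟩ := hx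
  have hinv : τ * τ⁻¹ = 1 := mul_inv_cancel₀ hτ0.ne'
  have hinv0 : 0 < τ⁻¹ := inv_pos.mpr hτ0
  rw [norm_waveU hτ0 hinv0, hinv, mul_one]
  set L := √((τ ^ 2 + x ^ 2) * (τ⁻¹ ^ 2 + 1 ^ 2)) with hL
  have hL0 : 0 ≤ L := Real.sqrt_nonneg _
  have hL2 : L ^ 2 = (τ ^ 2 + x ^ 2) * (τ⁻¹ ^ 2 + 1 ^ 2) := Real.sq_sqrt (by positivity)
  have hfac : (L + (1 - x)) * (L + (x - 1)) = (τ + x * τ⁻¹) ^ 2 := by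
    linear_combination hL2 + (τ * τ⁻¹ + 1 - 2 * x) * hinv
  have hLx : x - 1 ≤ L := by
    refine abs_le_of_sq_le_sq' ?_ hL0 |>.2
    nlinarith [sq_nonneg (τ + x * τ⁻¹)]
  have him : τ + x * τ⁻¹ ≤ 3 * τ := by
    have : x * τ⁻¹ ≤ 2 * τ ^ 2 * τ⁻¹ := by gcongr
    have h2 : 2 * τ ^ 2 * τ⁻¹ = 2 * τ := by linear_combination 2 * τ * hinv
    linarith
  have hxi : 0 ≤ x * τ⁻¹ := mul_nonneg ((sq_nonneg τ).trans hx1) hinv0.le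
  -- Now `Re αβ = 1 - x` is negative and nearly cancels `L`: the quotient of `(Im αβ)² ≤ 9τ²` by `L
  -- + x - 1 ≥ τ²` stays bounded, so `u` has size `1/τ` on an interval of length `τ²`.
  have hP : L + (1 - x) ≤ 9 := by
    by_contra h
    push Not at h
    have h1 : (τ + x * τ⁻¹) ^ 2 ≤ (3 * τ) ^ 2 := by gcongr
    have h2 : τ ^ 2 ≤ L + (x - 1) := by nlinarith
    nlinarith [mul_lt_mul h h2 (by positivity) (by linarith)]
  have h5 : √(2 * (L + (1 - x))) ≤ 5 := Real.sqrt_le_iff.mpr ⟨by norm_num, by linarith⟩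
  have h6 : √√(τ ^ 2 + x ^ 2) ≤ 2 * τ := by
    refine Real.sqrt_le_iff.mpr ⟨by positivity, Real.sqrt_le_iff.mpr ⟨by positivity, ?_⟩⟩
    have h8 : 1 ≤ τ ^ 2 := by nlinarith
    nlinarith [mul_le_mul hx2 hx2 ((sq_nonneg τ).trans hx1) (by positivity),
      mul_le_mul_of_nonneg_left h8 (sq_nonneg τ)]
  have h7 : 0 < √√(τ ^ 2 + x ^ 2) := Real.sqrt_pos.mpr (Real.sqrt_pos.mpr (by positivity))
  exact div_le_div₀ (Real.exp_pos _).le (Real.exp_le_exp.mpr (neg_le_neg h5)) h7 h6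

theorem norm_waveU_zero_toLp {p : ℝ≥0∞} {τ : ℝ} (hτ : 0 < τ) (h : MemLp (waveU τ τ⁻¹ 0) p)
    (h1 : MemLp (waveU 1 1 0) p) :
    ‖h.toLp (waveU τ τ⁻¹ 0)‖ =
      (√τ)⁻¹ * (τ ^ (1 / p.toReal) * ‖h1.toLp (waveU 1 1 0)‖) := by
  rw [Lp.norm_toLp, Lp.norm_toLp, ← eLpNorm_norm (waveU 1 1 0),
    ← toReal_eLpNorm_const_mul_comp_div
      (continuous_waveU one_pos 1 0).norm hτ (by positivity)]
  congr 1
  refine eLpNorm_congr_norm_ae (.of_forall fun x => ?_)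
  rw [norm_waveU_zero hτ, Real.norm_of_nonneg (by positivity)]

variable {p : ℝ≥0∞} [Fact (1 ≤ p)]

theorem norm_waveU_zero_toLp_pos (h1 : MemLp (waveU 1 1 0) p) :
    0 < ‖h1.toLp (waveU 1 1 0)‖ := by
  rw [norm_pos_iff]
  intro h0
  have h2 : waveU 1 1 0 =ᵐ[volume] 0 := by
    have := h1.coeFn_toLp
    rw [h0] at this
    exact this.symm.trans (Lp.coeFn_zero _ _ _)
  obtain ⟨x, hx⟩ := h2.exists
  exact div_ne_zero (Complex.exp_ne_zero _) (csqrt_ne_zero _) hx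

theorem norm_waveU_neg_one_toLp_le (hp : p ≠ ⊤) {τ : ℝ} (hτ : 1 ≤ τ)
    (h : MemLp (waveU τ τ⁻¹ (-1)) p) :
    ‖h.toLp (waveU τ τ⁻¹ (-1))‖ ≤ 30720 * τ⁻¹ * ((τ ^ 2) ^ (1 / p.toReal) *
      (eLpNorm (fun x : ℝ => (1 + x ^ 2)⁻¹) p volume).toReal) := by
  have hτ0 : 0 < τ := one_pos.trans_le hτ
  have hcont : Continuous fun x : ℝ => (1 + x ^ 2)⁻¹ :=
    Continuous.inv₀ (by fun_prop) fun x => by positivity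
  rw [Lp.norm_toLp, ← toReal_eLpNorm_const_mul_comp_div hcont (c := τ ^ 2) (by positivity)
    (by positivity)]
  refine ENNReal.toReal_mono ?_ (eLpNorm_mono_real fun x => norm_waveU_neg_one_le hτ x)
  have hm := memLp_inv_one_add_sq (Fact.out : 1 ≤ p) hp
  have hm' : MemLp (fun x : ℝ => (1 + (x / τ ^ 2) ^ 2)⁻¹) p := by
    refine ⟨(hcont.comp (continuous_id.div_const (τ ^ 2))).aestronglyMeasurable, ?_⟩
    rw [eLpNorm_comp_div hcont (c := τ ^ 2) (by positivity)]
    exact ENNReal.mul_lt_top (ENNReal.rpow_lt_top_of_nonneg (by positivity)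
      ENNReal.ofReal_ne_top) hm.2
  exact (hm'.const_mul _).2.ne

theorem le_norm_waveU_one_toLp (hp : p ≠ ⊤) {τ : ℝ} (hτ : 2 ≤ τ) (h : MemLp (waveU τ τ⁻¹ 1) p) :
    Real.exp (-5) / (2 * τ) * (τ ^ 2) ^ (1 / p.toReal) ≤ ‖h.toLp (waveU τ τ⁻¹ 1)‖ := by
  have hτ0 : 0 < τ := two_pos.trans_le hτ
  have hv : volume (Icc (τ ^ 2) (2 * τ ^ 2)) ≠ ⊤ := measure_Icc_lt_top.ne
  have hc : 0 ≤ Real.exp (-5) / (2 * τ) := by positivity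
  have hn := norm_indicatorConstLp (p := p) (hs := measurableSet_Icc) (hμs := hv)
    (c := ((Real.exp (-5) / (2 * τ) : ℝ) : ℂ)) (zero_lt_one.trans_le Fact.out).ne' hp
  rw [Real.volume_real_Icc_of_le (by nlinarith), Complex.norm_real, Real.norm_of_nonneg hc,
    show 2 * τ ^ 2 - τ ^ 2 = τ ^ 2 by ring] at hn
  rw [← hn]
  refine Lp.norm_le_norm_of_ae_le ?_
  filter_upwards [h.coeFn_toLp, indicatorConstLp_coeFn (p := p) (hs := measurableSet_Icc)
    (hμs := hv) (c := ((Real.exp (-5) / (2 * τ) : ℝ) : ℂ))] with x h₁ h₂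
  rw [h₁, h₂, norm_indicator_eq_indicator_norm, Complex.norm_real, Real.norm_of_nonneg hc]
  by_cases hx : x ∈ Icc (τ ^ 2) (2 * τ ^ 2)
  · rw [indicator_of_mem hx]
    exact le_norm_waveU_one hτ hx
  · rw [indicator_of_notMem hx]
    exact norm_nonneg _

theorem not_forall_rpow_le {r C : ℝ} (hr : 0 < r) : ¬ ∀ τ : ℝ, 2 ≤ τ → τ ^ r ≤ C := by
  intro h
  obtain ⟨τ, h1, h2⟩ := (((tendsto_rpow_atTop hr).eventually_gt_atTop C).and
    (eventually_ge_atTop 2)).exists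
  exact (h τ h2).not_gt h1

/-- On `L^p(ℝ)`, `p ≠ 2`, the inverse of the generator of the shift group is not a generator. -/
theorem eq_two_of_generates (hp1 : 1 < p) (hp : p ≠ ⊤)
    (hgen : GeneratesC0Semigroup (shiftGenerator p).inverse) : p = 2 := by
  obtain ⟨T, hT, hA⟩ := hgen
  have hp1' : 1 < p.toReal := by
    simpa using (ENNReal.toReal_lt_toReal ENNReal.one_ne_top hp).mpr hp1
  have hκ := norm_waveU_zero_toLp_pos (memLp_waveU hp1.le hp one_pos one_pos 0)
  set κ := ‖(memLp_waveU hp1.le hp one_pos one_pos 0).toLp (waveU 1 1 0)‖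
  set q := 1 / p.toReal with hq
  have hroot : ∀ τ : ℝ, 0 < τ → (√τ)⁻¹ = τ ^ (-(1 / 2) : ℝ) := fun τ hτ => by
    rw [Real.sqrt_eq_rpow, Real.rpow_neg hτ.le]
  have hsq : ∀ τ : ℝ, 0 < τ → (τ ^ 2) ^ q = τ ^ (2 * q) := fun τ hτ => by
    rw [← Real.rpow_natCast, ← Real.rpow_mul hτ.le, Nat.cast_ofNat]
  have key : p.toReal = 2 := by
    rcases lt_trichotomy p.toReal 2 with hlt | heq | hgt
    · exfalso
      have hr : 0 < q - 1 / 2 := sub_pos.mpr (one_div_lt_one_div_of_lt (by linarith) hlt)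
      refine not_forall_rpow_le (C := 2 * Real.exp 5 * (‖T 1‖ * κ)) hr fun τ hτ => ?_
      have hτ0 : 0 < τ := two_pos.trans_le hτ
      -- Passing from time `0` to `1` would give `τ^(2q - 1) ≤ C τ^(q - 1/2)` with `q > 1/2`.
      have h1 := apply_waveU_of_generates hp1 hp hT hA hτ0 (inv_pos.mpr hτ0) 0 1
      simp only [zero_add, NNReal.coe_one] at h1
      have h2 := (T 1).le_opNorm
        ((memLp_waveU hp1.le hp hτ0 (inv_pos.mpr hτ0) 0).toLp (waveU τ τ⁻¹ 0))
      rw [h1, norm_waveU_zero_toLp hτ0 _ (memLp_waveU hp1.le hp one_pos one_pos 0)] at h2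
      have h3 := (le_norm_waveU_one_toLp hp hτ _).trans h2
      rw [← hq, hsq τ hτ0, hroot τ hτ0] at h3
      have e1 : τ ^ (q - 1 / 2) = τ ^ (2 * q) * τ⁻¹ * τ ^ (1 / 2 - q : ℝ) := by
        rw [← Real.rpow_neg_one, ← Real.rpow_add hτ0, ← Real.rpow_add hτ0]
        ring_nf
      have e2 : τ ^ (-(1 / 2) : ℝ) * τ ^ q * τ ^ (1 / 2 - q : ℝ) = 1 := by
        rw [← Real.rpow_add hτ0, ← Real.rpow_add hτ0]
        ring_nf
        exact Real.rpow_zero τ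
      have e3 : Real.exp 5 * Real.exp (-5) = 1 := by rw [← Real.exp_add]; simp
      have h4 := mul_le_mul_of_nonneg_left h3
        (by positivity : 0 ≤ 2 * Real.exp 5 * τ ^ (1 / 2 - q : ℝ))
      calc τ ^ (q - 1 / 2) = (Real.exp 5 * Real.exp (-5)) *
            (τ ^ (2 * q) * τ⁻¹ * τ ^ (1 / 2 - q : ℝ)) := by rw [e3, one_mul, e1]
        _ = 2 * Real.exp 5 * τ ^ (1 / 2 - q : ℝ) *
            (Real.exp (-5) / (2 * τ) * τ ^ (2 * q)) := by field_simp
        _ ≤ _ := h4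
        _ = 2 * Real.exp 5 * (‖T 1‖ * κ) *
            (τ ^ (-(1 / 2) : ℝ) * τ ^ q * τ ^ (1 / 2 - q : ℝ)) := by ring
        _ = 2 * Real.exp 5 * (‖T 1‖ * κ) := by rw [e2, mul_one]
    · exact heq
    · exfalso
      have hr : 0 < 1 / 2 - q := sub_pos.mpr (one_div_lt_one_div_of_lt two_pos hgt)
      set K := (eLpNorm (fun x : ℝ => (1 + x ^ 2)⁻¹) p volume).toReal
      refine not_forall_rpow_le (C := ‖T 1‖ * (30720 * K) / κ) hr fun τ hτ => ?_
      have hτ0 : 0 < τ := two_pos.trans_le hτ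
      -- Passing from time `-1` to `0` would give `τ^(q - 1/2) ≤ C τ^(2q - 1)` with `q < 1/2`.
      have h1 := apply_waveU_of_generates hp1 hp hT hA hτ0 (inv_pos.mpr hτ0) (-1) 1
      simp only [NNReal.coe_one, neg_add_cancel] at h1
      have h2 := (T 1).le_opNorm
        ((memLp_waveU hp1.le hp hτ0 (inv_pos.mpr hτ0) (-1)).toLp (waveU τ τ⁻¹ (-1)))
      rw [h1, norm_waveU_zero_toLp hτ0 _ (memLp_waveU hp1.le hp one_pos one_pos 0)] at h2
      have h3 := h2.trans (mul_le_mul_of_nonneg_left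
        (norm_waveU_neg_one_toLp_le hp (one_le_two.trans hτ) _) (norm_nonneg _))
      rw [← hq, hsq τ hτ0, hroot τ hτ0] at h3
      have e1 : τ ^ (1 / 2 - q : ℝ) = τ ^ (-(1 / 2) : ℝ) * τ ^ q * (τ * τ ^ (-(2 * q))) := by
        nth_rewrite 4 [← Real.rpow_one τ]
        rw [← Real.rpow_add hτ0, ← Real.rpow_add hτ0, ← Real.rpow_add hτ0]
        ring_nf
      have e2 : τ ^ (2 * q) * τ ^ (-(2 * q)) = 1 := by
        rw [← Real.rpow_add hτ0]
        simp
      have h4 := mul_le_mul_of_nonneg_right h3 (by positivity : 0 ≤ τ * τ ^ (-(2 * q)))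
      rw [le_div_iff₀ hκ]
      calc τ ^ (1 / 2 - q : ℝ) * κ
          = τ ^ (-(1 / 2) : ℝ) * (τ ^ q * κ) * (τ * τ ^ (-(2 * q))) := by rw [e1]; ring
        _ ≤ _ := h4
        _ = ‖T 1‖ * (30720 * K) * (τ * τ⁻¹) * (τ ^ (2 * q) * τ ^ (-(2 * q))) := by ring
        _ = ‖T 1‖ * (30720 * K) := by rw [e2, mul_inv_cancel₀ hτ0.ne', mul_one, mul_one]
  rw [← ENNReal.ofReal_toReal hp, key, ENNReal.ofReal_ofNat]

end Asymptotics

end InverseGenerator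

theorem theorem3p2 (p : ℝ≥0∞) [Fact (1 ≤ p)] (hp_one : 1 < p) (hp_top : p < ⊤) :
    -- the shifts form a `C_0`-group of isometries, and `A_p` is its generator (both of the group
    -- and of the semigroup obtained by restriction to nonnegative times)
    InverseGenerator.IsC0Group (InverseGenerator.shift p) ∧
    (∀ (t : ℝ) (f : InverseGenerator.LpReal p), ‖InverseGenerator.shift p t f‖ = ‖f‖) ∧
    InverseGenerator.IsGroupGenerator
      (InverseGenerator.shiftGenerator p) (InverseGenerator.shift p) ∧
    InverseGenerator.IsSemigroupGenerator
      (InverseGenerator.shiftGenerator p) (fun t : ℝ≥0 => InverseGenerator.shift p (t : ℝ)) ∧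
    -- `A_p` is injective with dense range
    Function.Injective (InverseGenerator.shiftGenerator p) ∧
    Dense (Set.range (InverseGenerator.shiftGenerator p)) ∧
    -- the inverse `A_p⁻¹`, with domain the range of `A_p`, generates a `C_0`-semigroup iff `p = 2`
    (InverseGenerator.GeneratesC0Semigroup (InverseGenerator.shiftGenerator p).inverse ↔
      p = 2) := by
  have hp : p ≠ ⊤ := hp_top.ne
  refine ⟨InverseGenerator.isC0Group_shift hp, InverseGenerator.norm_shift,
    InverseGenerator.isGroupGenerator_shift hp, InverseGenerator.isSemigroupGenerator_shift hp,
    InverseGenerator.injective_shiftGenerator hp_one hp,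
    InverseGenerator.dense_range_shiftGenerator hp_one hp,
    InverseGenerator.eq_two_of_generates hp_one hp, ?_⟩
  rintro rfl
  exact InverseGenerator.generatesC0Semigroup_inverse_two
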